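/- For $p\ge 1$ let $\gamma_p$ denote the ground-state energy, i.e. the minimal eigenvalue, of the (an)harmonic oscillator $-\frac{d^2}{dt^2}+|t|^p$ on $L^2(\mathbb R)$ (the closure of this operator defined on $C_0^\infty(\mathbb R)$); this minimal eigenvalue exists. For $\lambda\ge 0$ let $L_p(\lambda)$ be the closure of the operator $$\psi\mapsto -\Delta\psi+\Bigl(|xy|^p-\lambda\,(x^2+y^2)^{p/(p+2)}\Bigr)\psi,\qquad \psi\in C_0^\infty(\mathbb R^2),$$ in the complex Hilbert space $L^2(\mathbb R^2)$. Then for every $p\ge 1$ and every $0\le\lambda<\gamma_p$ the operator $L_p(\lambda)$ is self-adjoint and bounded from below (so that its spectrum is contained in $[c,\infty)$ for some $c\in\mathbb R$), and its spectrum is purely discrete: every point of the spectrum is an isolated point of it and an eigenvalue of finite multiplicity. -/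

import Mathlib

open scoped ContDiff InnerProductSpace Laplacian

noncomputable section

namespace Schrodinger

/-! ### Spectral notions for unbounded operators -/

section Spectral

variable {H : Type*} [NormedAddCommGroup H] [InnerProductSpace ℂ H]

/-- The eigenspace `{f ∈ dom A : A f = z f}` of an unbounded operator `A`. -/
def eigenspace (A : H →ₗ.[ℂ] H) (z : ℂ) : Submodule ℂ H :=
  A.graph.comap (LinearMap.id.prod (z • LinearMap.id))

/-- `z` is an eigenvalue of `A`. -/
def IsEigenvalue (A : H →ₗ.[ℂ] H) (z : ℂ) : Prop :=
  eigenspace A z ≠ ⊥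

/-- The resolvent set: those `z` for which `A - z : dom A → H` has a two-sided inverse that is
a bounded operator on `H`. -/
def resolventSet (A : H →ₗ.[ℂ] H) : Set ℂ :=
  {z | ∃ R : H →L[ℂ] H,
    (∀ f : A.domain, R (A f - z • (f : H)) = f) ∧
    (∀ g : H, ∃ h : R g ∈ A.domain, A ⟨R g, h⟩ - z • R g = g)}

/-- The spectrum of an unbounded operator. -/
def spectrum (A : H →ₗ.[ℂ] H) : Set ℂ :=
  (resolventSet A)ᶜ

/-- The spectrum is purely discrete: it consists of isolated points, each of which is an
eigenvalue of finite multiplicity. -/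
def HasPurelyDiscreteSpectrum (A : H →ₗ.[ℂ] H) : Prop :=
  ∀ z ∈ spectrum A,
    ¬ AccPt z (Filter.principal (spectrum A)) ∧ IsEigenvalue A z ∧
      FiniteDimensional ℂ (eigenspace A z)

/-- `A` is bounded from below by `c`: `⟨f, A f⟩ ≥ c ‖f‖²` for all `f ∈ dom A`. -/
def IsBoundedBelowBy (A : H →ₗ.[ℂ] H) (c : ℝ) : Prop :=
  ∀ f : A.domain, c * ‖(f : H)‖ ^ 2 ≤ (inner ℂ (f : H) (A f)).re

end Spectral

/-! ### Schrödinger operators -/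

section Operators

variable {E : Type*} [NormedAddCommGroup E] [InnerProductSpace ℝ E] [FiniteDimensional ℝ E]
  [MeasurableSpace E] [BorelSpace E]

variable (E) in
/-- The complex Hilbert space `L²(E)` with respect to Lebesgue measure. -/
abbrev L2 : Type _ := MeasureTheory.Lp ℂ 2 (MeasureTheory.volume : MeasureTheory.Measure E)

/-- The differential expression `-Δψ + Vψ`. -/
def expr (V : E → ℝ) (ψ : E → ℂ) : E → ℂ :=
  fun x => -(Δ ψ) x + (V x : ℂ) * ψ x

/-- The graph of `ψ ↦ -Δψ + Vψ` on the smooth compactly supported functions `ψ : E → ℂ`. (If `V`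
is locally square integrable, in particular if it is continuous, then `-Δψ + Vψ` lies in `L²` for
every such `ψ`.) -/
def coreGraph (V : E → ℝ) : Submodule ℂ (L2 E × L2 E) where
  carrier := {q | ∃ ψ : E → ℂ, ContDiff ℝ ∞ ψ ∧ HasCompactSupport ψ ∧
    q.1 =ᵐ[MeasureTheory.volume] ψ ∧ q.2 =ᵐ[MeasureTheory.volume] expr V ψ}
  add_mem' := by
    rintro ⟨f, g⟩ ⟨f', g'⟩ ⟨ψ, hs, hc, h1, h2⟩ ⟨ψ', hs', hc', h1', h2'⟩
    refine ⟨ψ + ψ', hs.add hs', hc.add hc', ?_, ?_⟩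
    · exact (MeasureTheory.Lp.coeFn_add f f').trans (h1.add h1')
    · refine (MeasureTheory.Lp.coeFn_add g g').trans ((h2.add h2').trans (.of_eq ?_))
      funext x
      have := (hs.of_le (m := 2) (by norm_cast)).contDiffAt.laplacian_add (x := x)
        (hs'.of_le (m := 2) (by norm_cast)).contDiffAt
      simp only [expr, Pi.add_apply, this]
      ring
  zero_mem' := by
    refine ⟨0, contDiff_const, HasCompactSupport.zero, ?_, ?_⟩
    · exact MeasureTheory.Lp.coeFn_zero _ _ _
    · refine (MeasureTheory.Lp.coeFn_zero _ _ _).trans (.of_eq ?_)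
      funext x
      have : (Δ (0 : E → ℂ)) x = 0 := by
        exact congrFun (InnerProductSpace.laplacian_const (E := E) (c := (0 : ℂ))) x
      simp [expr, this]
  smul_mem' := by
    rintro c ⟨f, g⟩ ⟨ψ, hs, hc, h1, h2⟩
    refine ⟨c • ψ, contDiff_const.smul hs, hc.smul_left (f := fun _ => c), ?_, ?_⟩
    · exact (MeasureTheory.Lp.coeFn_smul c f).trans (h1.const_smul c)
    · refine (MeasureTheory.Lp.coeFn_smul c g).trans ((h2.const_smul c).trans (.of_eq ?_))
      funext x
      have := InnerProductSpace.laplacian_smul (x := x) c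
        (hs.of_le (m := 2) (by norm_cast)).contDiffAt
      simp only [expr, Pi.smul_apply, this, smul_eq_mul]
      ring

/-- `coreGraph V` is single-valued, that is, it is the graph of an operator. -/
theorem coreGraph_single (V : E → ℝ) :
    ∀ q ∈ coreGraph V, q.1 = 0 → q.2 = 0 := by
  rintro ⟨f, g⟩ ⟨ψ, hs, hc, h1, h2⟩ (rfl : f = 0)
  have h0 : ψ = 0 := by
    refine MeasureTheory.Measure.eq_of_ae_eq (h1.symm.trans (MeasureTheory.Lp.coeFn_zero _ _ _))
      hs.continuous continuous_zero
  subst h0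
  refine MeasureTheory.Lp.ext (h2.trans ((Filter.EventuallyEq.of_eq ?_).trans
    (MeasureTheory.Lp.coeFn_zero _ _ _).symm))
  funext x
  have : (Δ (0 : E → ℂ)) x = 0 := by
    exact congrFun (InnerProductSpace.laplacian_const (E := E) (c := (0 : ℂ))) x
  simp [expr, this]

/-- The operator `-Δ + V` on `L²(E)` with domain `C_c^∞(E)`. -/
def coreOperator (V : E → ℝ) : L2 E →ₗ.[ℂ] L2 E :=
  (coreGraph V).toLinearPMap

theorem coreOperator_graph (V : E → ℝ) : (coreOperator V).graph = coreGraph V :=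
  Submodule.toLinearPMap_graph_eq _ (coreGraph_single V)

/-- The Schrödinger operator `-Δ + V` on `L²(E)`: the closure of its restriction to
`C_c^∞(E)`. -/
def schrodinger (V : E → ℝ) : L2 E →ₗ.[ℂ] L2 E :=
  (coreOperator V).closure

end Operators

/-- The (an)harmonic oscillator `-d²/dt² + |t|^p` on `L²(ℝ)`. -/
def oscillator (p : ℝ) : L2 ℝ →ₗ.[ℂ] L2 ℝ :=
  schrodinger fun t : ℝ => |t| ^ p

/-- The ground-state energy `γ_p`: the lowest eigenvalue of `-d²/dt² + |t|^p`. -/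
def groundEnergy (p : ℝ) : ℝ :=
  sInf {μ : ℝ | IsEigenvalue (oscillator p) (μ : ℂ)}

/-- The operator `L_p(lam) = -Δ + |xy|^p - lam (x² + y²)^{p/(p+2)}` on `L²(ℝ²)`. -/
def L (p lam : ℝ) : L2 (EuclideanSpace ℝ (Fin 2)) →ₗ.[ℂ] L2 (EuclideanSpace ℝ (Fin 2)) :=
  schrodinger fun v => |v 0 * v 1| ^ p - lam * ((v 0) ^ 2 + (v 1) ^ 2) ^ (p / (p + 2))

end Schrodinger

end

/-!
The proof compares `L p lam` with the critical operator `L p γ`, where `γ = groundEnergy p`. On the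
line `x = const` the potential `|x y|^p` gives a rescaled anharmonic oscillator, whose ground-state
energy is `γ |x|^{2p/(p+2)}`; this is exactly what the negative term takes away in the channel along
the `x`-axis. An IMS partition into two channels and a region away from the axes, where `|x y|^p`
dominates, therefore shows that the form of `L p γ` is bounded from below. For `lam < γ` a convex
combination leaves room to spare: the form of `L p lam` dominates
`∫ ε |∇ψ|² + (δ (x² + y²)^{p/(p+2)} - C) |ψ|²`.

A Schrödinger operator with such a lower bound, with a weight that tends to infinity, has compact
resolvent. A function orthogonal to the range of `A + μ` is a weak solution; testing the form with
its mollifications, cut off by a slowly varying function, shows that it vanishes, so that `A + μ` is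
onto after taking the closure. Functions with bounded form are precompact in `L²`, because they are
uniformly small at infinity and uniformly close to their mollifications. Self-adjointness and
discreteness of the spectrum follow from the spectral theory of compact symmetric operators, and
the same argument in dimension one yields the ground state of the oscillator.
-/

noncomputable section

open MeasureTheory Filter Topology

open scoped ComplexConjugate

namespace Schrodinger

section CompactOperators

variable {𝕜 H : Type*} [RCLike 𝕜] [NormedAddCommGroup H] [InnerProductSpace 𝕜 H]

theorem finite_of_totallyBounded_of_le_dist {ι X : Type*} [PseudoMetricSpace X] {u : ι → X}
    (hu : TotallyBounded (Set.range u)) {c : ℝ} (hc : 0 < c)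
    (hdist : Pairwise fun i j => c ≤ dist (u i) (u j)) : Finite ι := by
  obtain ⟨t, ht, hcover⟩ := Metric.totallyBounded_iff.1 hu (c / 2) (half_pos hc)
  have hnear : ∀ i, ∃ y ∈ t, dist (u i) y < c / 2 := fun i => by
    simpa using hcover (Set.mem_range_self i)
  choose y hyt hy using hnear
  have := ht.to_subtype
  refine Finite.of_injective (fun i => (⟨y i, hyt i⟩ : t)) fun i j hij => ?_
  by_contra hne
  have hyij : y i = y j := congrArg Subtype.val hij
  have htri : dist (u i) (u j) ≤ dist (u i) (y i) + dist (u j) (y i) := dist_triangle_right _ _ _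
  have hyj : dist (u j) (y i) < c / 2 := hyij ▸ hy j
  linarith [hdist hne, hy i]

theorem finite_of_orthonormal_eigenvectors {T : H →L[𝕜] H} (hT : IsCompactOperator T)
    {ι : Type*} {e : ι → H} (he : Orthonormal 𝕜 e) {κ : ι → 𝕜} (hκ : ∀ i, T (e i) = κ i • e i)
    {c : ℝ} (hc : 0 < c) (hcκ : ∀ i, c ≤ ‖κ i‖) : Finite ι := by
  obtain ⟨K, hK, hsub⟩ := IsCompactOperator.image_closedBall_subset_compact
    (f := (T : H →ₗ[𝕜] H)) hT 1
  have hrange : Set.range (fun i => T (e i)) ⊆ K := by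
    rintro _ ⟨i, rfl⟩
    exact hsub ⟨e i, by simp [he.1 i], rfl⟩
  refine finite_of_totallyBounded_of_le_dist (hK.totallyBounded.subset hrange) hc
    fun i j hij => ?_
  have hnorm : ∀ k, ‖T (e k)‖ = ‖κ k‖ := fun k => by rw [hκ, norm_smul, he.1, mul_one]
  have horth : inner 𝕜 (T (e i)) (T (e j)) = 0 := by
    rw [hκ, hκ, inner_smul_left, inner_smul_right, he.2 hij, mul_zero, mul_zero]
  have hpyth : ‖T (e i) - T (e j)‖ ^ 2 = ‖κ i‖ ^ 2 + ‖κ j‖ ^ 2 := by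
    rw [@norm_sub_sq 𝕜, horth, hnorm, hnorm]
    simp
  change c ≤ dist (T (e i)) (T (e j))
  rw [dist_eq_norm]
  refine (hcκ i).trans (le_of_sq_le_sq ?_ (norm_nonneg _))
  rw [hpyth]
  linarith [sq_nonneg ‖κ j‖]

theorem finite_setOf_hasEigenvalue_of_le_norm {T : H →L[𝕜] H} (hT : IsCompactOperator T)
    (hsymm : (T : H →ₗ[𝕜] H).IsSymmetric) {c : ℝ} (hc : 0 < c) :
    {κ : 𝕜 | c ≤ ‖κ‖ ∧ Module.End.HasEigenvalue (T : H →ₗ[𝕜] H) κ}.Finite := by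
  set S := {κ : 𝕜 | c ≤ ‖κ‖ ∧ Module.End.HasEigenvalue (T : H →ₗ[𝕜] H) κ}
  have hunit : ∀ κ : S, ∃ e : Module.End.eigenspace (T : H →ₗ[𝕜] H) (κ : 𝕜), ‖e‖ = 1 := by
    rintro ⟨κ, -, hκ⟩
    obtain ⟨f, hf⟩ := hκ.exists_hasEigenvector
    have hne : (⟨f, hf.1⟩ : Module.End.eigenspace (T : H →ₗ[𝕜] H) κ) ≠ 0 := by
      simpa using hf.2
    exact ⟨_, norm_smul_inv_norm (𝕜 := 𝕜) hne⟩
  choose e he using hunit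
  have horth : Orthonormal 𝕜 fun κ : S => (e κ : H) :=
    ⟨he, fun κ κ' hne => hsymm.orthogonalFamily_eigenspaces (Subtype.coe_ne_coe.2 hne) _ _⟩
  exact finite_of_orthonormal_eigenvectors hT horth
    (fun κ => Module.End.mem_eigenspace_iff.1 (e κ).2) hc fun κ => κ.2.1

-- Expand `0 ≤ ⟪T (x - ‖T‖⁻¹ T x), x - ‖T‖⁻¹ T x⟫`.
theorem norm_apply_sq_le_norm_mul_re_inner {T : H →L[𝕜] H} (hT : T.IsPositive) (x : H) :
    ‖T x‖ ^ 2 ≤ ‖T‖ * RCLike.re (inner 𝕜 (T x) x) := by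
  rcases (norm_nonneg T).eq_or_lt with h0 | hpos
  · simp [norm_eq_zero.1 h0.symm]
  set t : ℝ := ‖T‖⁻¹
  have hexpand : RCLike.re (inner 𝕜 (T (x - (t : 𝕜) • T x)) (x - (t : 𝕜) • T x))
      = RCLike.re (inner 𝕜 (T x) x) - 2 * t * ‖T x‖ ^ 2
        + t ^ 2 * RCLike.re (inner 𝕜 (T (T x)) (T x)) := by
    rw [map_sub, map_smul, inner_sub_left, inner_sub_right, inner_sub_right, inner_smul_left,
      inner_smul_left, inner_smul_right, inner_smul_right, RCLike.conj_ofReal,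
      hT.inner_left_eq_inner_right (T x) x, ← inner_self_eq_norm_sq (𝕜 := 𝕜) (T x)]
    simp only [map_sub, RCLike.re_ofReal_mul]
    ring
  have hnonneg := hT.re_inner_nonneg_left (x - (t : 𝕜) • T x)
  have hle : RCLike.re (inner 𝕜 (T (T x)) (T x)) ≤ ‖T‖ * ‖T x‖ ^ 2 :=
    calc RCLike.re (inner 𝕜 (T (T x)) (T x)) ≤ ‖T (T x)‖ * ‖T x‖ := re_inner_le_norm _ _
      _ ≤ ‖T‖ * ‖T x‖ * ‖T x‖ := by gcongr; exact T.le_opNorm _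
      _ = ‖T‖ * ‖T x‖ ^ 2 := by ring
  have htT : t * ‖T‖ = 1 := inv_mul_cancel₀ hpos.ne'
  have hsecond : t ^ 2 * RCLike.re (inner 𝕜 (T (T x)) (T x)) ≤ t * ‖T x‖ ^ 2 :=
    calc t ^ 2 * RCLike.re (inner 𝕜 (T (T x)) (T x)) ≤ t ^ 2 * (‖T‖ * ‖T x‖ ^ 2) := by gcongr
      _ = t * ‖T‖ * (t * ‖T x‖ ^ 2) := by ring
      _ = t * ‖T x‖ ^ 2 := by rw [htT, one_mul]
  have hkey : t * ‖T x‖ ^ 2 ≤ RCLike.re (inner 𝕜 (T x) x) := by linarith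
  rwa [← inv_mul_le_iff₀ hpos]

theorem hasEigenvalue_norm_of_isPositive {H : Type*} [NormedAddCommGroup H]
    [InnerProductSpace ℂ H] [CompleteSpace H] {T : H →L[ℂ] H} (hpos : T.IsPositive)
    (hT : IsCompactOperator T) (h0 : T ≠ 0) :
    Module.End.HasEigenvalue (T : H →ₗ[ℂ] H) (‖T‖ : ℂ) := by
  have : Nontrivial (H →L[ℂ] H) := ⟨T, 0, h0⟩
  have hmem := CStarAlgebra.norm_mem_spectrum_of_nonneg
    ((ContinuousLinearMap.nonneg_iff_isPositive T).2 hpos)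
  exact (hT.hasEigenvalue_iff_mem_spectrum (by simpa using h0)).2
    (_root_.spectrum.algebraMap_mem ℂ hmem)

theorem isCompactOperator_of_forall_norm_le_add {𝕜 X Y : Type*} [RCLike 𝕜]
    [NormedAddCommGroup X] [NormedSpace 𝕜 X] [NormedAddCommGroup Y] [NormedSpace 𝕜 Y]
    [CompleteSpace Y] {T : X →L[𝕜] Y}
    (h : ∀ ε > 0, ∃ (N : ℕ) (S : X →L[𝕜] (Fin N → 𝕜)), ∀ x, ‖T x‖ ≤ ε * ‖x‖ + ‖S x‖) :
    IsCompactOperator T := by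
  change IsCompactOperator (T : X →ₗ[𝕜] Y)
  rw [isCompactOperator_iff_isCompact_closure_image_closedBall (T : X →ₗ[𝕜] Y) one_pos]
  refine TotallyBounded.isCompact_of_isClosed (TotallyBounded.closure ?_) isClosed_closure
  rw [Metric.totallyBounded_iff]
  intro ε hε
  obtain ⟨N, S, hS⟩ := h (ε / 4) (by positivity)
  have hSbounded := S.lipschitz.isBounded_image (Metric.isBounded_closedBall (x := 0) (r := 1))
  have hSball : TotallyBounded (S '' Metric.closedBall 0 1) :=
    hSbounded.isCompact_closure.totallyBounded.subset subset_closure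
  obtain ⟨t, htsub, htfin, htcover⟩ :=
    Metric.finite_approx_of_totallyBounded hSball (ε / 2) (by positivity)
  choose! k hk hSk using fun y (hy : y ∈ t) => htsub hy
  refine ⟨(fun y => T (k y)) '' t, htfin.image _, ?_⟩
  rintro _ ⟨x, hx, rfl⟩
  obtain ⟨y, hy, hxy⟩ := Set.mem_iUnion₂.1 (htcover ⟨x, hx, rfl⟩)
  refine Set.mem_iUnion₂.2 ⟨T (k y), ⟨y, hy, rfl⟩, ?_⟩
  have hnorm : ‖x - k y‖ ≤ 2 := by
    have hky := hk y hy
    rw [mem_closedBall_zero_iff] at hx hky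
    linarith [norm_sub_le x (k y)]
  have hSnorm : ‖S (x - k y)‖ < ε / 2 := by
    rwa [map_sub, hSk y hy, ← dist_eq_norm]
  rw [Metric.mem_ball, dist_eq_norm]
  calc ‖T x - T (k y)‖ = ‖T (x - k y)‖ := by rw [map_sub]
    _ ≤ ε / 4 * ‖x - k y‖ + ‖S (x - k y)‖ := hS _
    _ < ε / 4 * 2 + ε / 2 := add_lt_add_of_le_of_lt (by gcongr) hSnorm
    _ = ε := by ring

end CompactOperators

section CompactResolvent

variable {H : Type*} [NormedAddCommGroup H] [InnerProductSpace ℂ H]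

theorem mem_eigenspace_iff_mem_graph {A : H →ₗ.[ℂ] H} {z : ℂ} {f : H} :
    f ∈ eigenspace A z ↔ (f, z • f) ∈ A.graph :=
  Iff.rfl

theorem inner_self_eq_ofReal (f : H) : inner ℂ f f = ((‖f‖ ^ 2 : ℝ) : ℂ) := by
  rw [inner_self_eq_norm_sq_to_K]
  norm_cast

theorem exists_mem_domain_of_isEigenvalue {A : H →ₗ.[ℂ] H} {z : ℂ} (hz : IsEigenvalue A z) :
    ∃ f : A.domain, (f : H) ≠ 0 ∧ A f = z • (f : H) := by
  obtain ⟨f, hf, hf0⟩ := Submodule.exists_mem_ne_zero_of_ne_bot hz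
  obtain ⟨y, rfl, hAy⟩ := (LinearPMap.mem_graph_iff A).1 (mem_eigenspace_iff_mem_graph.1 hf)
  exact ⟨y, hf0, hAy⟩

theorem IsBoundedBelowBy.le_re_of_isEigenvalue {A : H →ₗ.[ℂ] H} {c : ℝ}
    (hA : IsBoundedBelowBy A c) {z : ℂ} (hz : IsEigenvalue A z) : c ≤ z.re := by
  obtain ⟨f, hf0, hf⟩ := exists_mem_domain_of_isEigenvalue hz
  have hbound := hA f
  rw [hf, inner_smul_right, inner_self_eq_ofReal, Complex.re_mul_ofReal] at hbound
  exact le_of_mul_le_mul_right hbound (by positivity)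

theorem im_eq_zero_of_isEigenvalue {A : H →ₗ.[ℂ] H} (hA : A.IsFormalAdjoint A) {z : ℂ}
    (hz : IsEigenvalue A z) : z.im = 0 := by
  obtain ⟨f, hf0, hf⟩ := exists_mem_domain_of_isEigenvalue hz
  have hsymm := hA f f
  rw [hf, inner_smul_left, inner_smul_right] at hsymm
  exact Complex.conj_eq_iff_im.1 (mul_right_cancel₀ (inner_self_ne_zero.2 hf0) hsymm)

/-- The operator `A + μ` as a linear map on the domain of the unbounded operator `A`. -/
def shift (A : H →ₗ.[ℂ] H) (μ : ℝ) : A.domain →ₗ[ℂ] H :=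
  A.toFun + (μ : ℂ) • A.domain.subtype

theorem shift_apply (A : H →ₗ.[ℂ] H) (μ : ℝ) (f : A.domain) :
    shift A μ f = A f + (μ : ℂ) • (f : H) :=
  rfl

theorem re_inner_shift (A : H →ₗ.[ℂ] H) (μ : ℝ) (f : A.domain) :
    (inner ℂ (f : H) (shift A μ f)).re = (inner ℂ (f : H) (A f)).re + μ * ‖(f : H)‖ ^ 2 := by
  rw [shift_apply, inner_add_right, inner_smul_right, inner_self_eq_ofReal, Complex.add_re,
    ← Complex.ofReal_mul, Complex.ofReal_re]

/-- `R` is a compact symmetric operator inverse to `A + μ`, and `A + μ ≥ 1`. The first property is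
expressed through the graph of `A`, the last one through `R`. -/
structure IsCompactResolvent (A : H →ₗ.[ℂ] H) (μ : ℝ) (R : H →L[ℂ] H) : Prop where
  mem_graph_iff : ∀ f g : H, (f, g) ∈ A.graph ↔ R (g + (μ : ℂ) • f) = f
  compact : IsCompactOperator R
  symmetric : ∀ f g : H, inner ℂ (R f) g = inner ℂ f (R g)
  lower : ∀ g : H, ‖R g‖ ^ 2 ≤ (inner ℂ (R g) g).re

namespace IsCompactResolvent

variable {A : H →ₗ.[ℂ] H} {μ : ℝ} {R : H →L[ℂ] H}

theorem apply_mem_graph (h : IsCompactResolvent A μ R) (g : H) :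
    (R g, g - (μ : ℂ) • R g) ∈ A.graph := by
  rw [h.mem_graph_iff, sub_add_cancel]

theorem apply_mem_domain (h : IsCompactResolvent A μ R) (g : H) : R g ∈ A.domain :=
  LinearPMap.mem_domain_of_mem_graph (h.apply_mem_graph g)

theorem apply_shift (h : IsCompactResolvent A μ R) (f : A.domain) : R (shift A μ f) = f :=
  (h.mem_graph_iff _ _).1 (A.mem_graph f)

theorem map_apply (h : IsCompactResolvent A μ R) (g : H) (hg : R g ∈ A.domain) :
    A ⟨R g, hg⟩ = g - (μ : ℂ) • R g :=
  A.mem_graph_snd_inj' (A.mem_graph ⟨R g, hg⟩) (h.apply_mem_graph g) rfl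

theorem eq_zero_of_apply_eq_zero (h : IsCompactResolvent A μ R) {g : H} (hg : R g = 0) :
    g = 0 := by
  have hmem := h.apply_mem_graph g
  rw [hg] at hmem
  simpa using A.graph_fst_eq_zero_snd hmem rfl

theorem ne_zero [Nontrivial H] (h : IsCompactResolvent A μ R) : R ≠ 0 := by
  rintro rfl
  obtain ⟨x, hx⟩ := exists_ne (0 : H)
  exact hx (h.eq_zero_of_apply_eq_zero rfl)

theorem isPositive (h : IsCompactResolvent A μ R) : R.IsPositive :=
  ⟨h.symmetric, fun g => (sq_nonneg _).trans (h.lower g)⟩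

theorem mem_eigenspace_iff (h : IsCompactResolvent A μ R) (z : ℂ) (f : H) :
    f ∈ eigenspace A z ↔ (z + μ) • R f = f := by
  rw [mem_eigenspace_iff_mem_graph, h.mem_graph_iff, ← add_smul, map_smul]

theorem eigenspace_eq (h : IsCompactResolvent A μ R) {z : ℂ} (hz : z + μ ≠ 0) :
    eigenspace A z = Module.End.eigenspace (R : H →ₗ[ℂ] H) (z + μ)⁻¹ := by
  ext f
  rw [h.mem_eigenspace_iff, Module.End.mem_eigenspace_iff, eq_inv_smul_iff₀ hz]
  rfl

theorem isEigenvalue_iff (h : IsCompactResolvent A μ R) {z : ℂ} (hz : z + μ ≠ 0) :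
    IsEigenvalue A z ↔ Module.End.HasEigenvalue (R : H →ₗ[ℂ] H) (z + μ)⁻¹ := by
  rw [IsEigenvalue, h.eigenspace_eq hz, Module.End.hasEigenvalue_iff]

theorem add_ne_zero_of_isEigenvalue (h : IsCompactResolvent A μ R) {z : ℂ}
    (hz : IsEigenvalue A z) : z + μ ≠ 0 := by
  intro h0
  obtain ⟨f, hf, hf0⟩ := Submodule.exists_mem_ne_zero_of_ne_bot hz
  rw [h.mem_eigenspace_iff, h0, zero_smul] at hf
  exact hf0 hf.symm

theorem isBoundedBelowBy (h : IsCompactResolvent A μ R) : IsBoundedBelowBy A (1 - μ) := by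
  intro f
  have hlower := h.lower (shift A μ f)
  rw [h.apply_shift, re_inner_shift] at hlower
  linarith

theorem isBoundedBelowBy_inv_norm_sub [Nontrivial H] (h : IsCompactResolvent A μ R) :
    IsBoundedBelowBy A (‖R‖⁻¹ - μ) := by
  intro f
  have hle := norm_apply_sq_le_norm_mul_re_inner h.isPositive (shift A μ f)
  rw [← inv_mul_le_iff₀ (norm_pos_iff.2 h.ne_zero), h.apply_shift] at hle
  have hshift := re_inner_shift A μ f
  rw [RCLike.re_eq_complex_re] at hle
  linarith

theorem isFormalAdjoint (h : IsCompactResolvent A μ R) : A.IsFormalAdjoint A := by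
  intro f g
  have hsymm := h.symmetric (shift A μ f) (shift A μ g)
  rw [h.apply_shift, h.apply_shift, shift_apply, shift_apply, inner_add_left, inner_add_right,
    inner_smul_left, inner_smul_right, Complex.conj_ofReal] at hsymm
  exact (add_right_cancel hsymm).symm

variable [CompleteSpace H]

theorem dense_domain (h : IsCompactResolvent A μ R) : Dense (A.domain : Set H) := by
  rw [Submodule.dense_iff_topologicalClosure_eq_top, Submodule.topologicalClosure_eq_top_iff,
    Submodule.eq_bot_iff]
  intro u hu
  apply h.eq_zero_of_apply_eq_zero
  rw [← inner_self_eq_zero (𝕜 := ℂ), h.symmetric]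
  exact (Submodule.mem_orthogonal' _ _).1 hu _ (h.apply_mem_domain _)

theorem isSelfAdjoint (h : IsCompactResolvent A μ R) : IsSelfAdjoint A := by
  rw [LinearPMap.isSelfAdjoint_def]
  have hdense := h.dense_domain
  refine le_antisymm (LinearPMap.le_of_le_graph ?_)
    (LinearPMap.IsFormalAdjoint.le_adjoint hdense h.isFormalAdjoint)
  rintro ⟨u, v⟩ huv
  obtain ⟨y, rfl, rfl⟩ := (LinearPMap.mem_graph_iff _).1 huv
  rw [h.mem_graph_iff]
  refine ext_inner_right ℂ fun g => ?_
  have hadj := LinearPMap.adjoint_isFormalAdjoint hdense y ⟨R g, h.apply_mem_domain g⟩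
  rw [h.map_apply, inner_sub_right, inner_smul_right] at hadj
  rw [h.symmetric, inner_add_left, inner_smul_left, Complex.conj_ofReal, hadj, sub_add_cancel]

theorem isUnit_one_sub_smul (h : IsCompactResolvent A μ R) {z : ℂ} (hz : ¬ IsEigenvalue A z) :
    IsUnit (1 - (z + μ) • R) := by
  by_cases h0 : z + μ = 0
  · simp [h0]
  rw [h.isEigenvalue_iff h0] at hz
  have hunit : IsUnit (algebraMap ℂ (H →L[ℂ] H) (z + μ)⁻¹ - R) :=
    (h.compact.hasEigenvalue_or_mem_resolventSet (inv_ne_zero h0)).resolve_left hz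
  have hscale : 1 - (z + μ) • R =
      Units.mk0 (z + μ) h0 • (algebraMap ℂ (H →L[ℂ] H) (z + μ)⁻¹ - R) := by
    rw [Units.smul_def, Units.val_mk0, smul_sub, Algebra.algebraMap_eq_smul_one,
      smul_inv_smul₀ h0]
  rw [hscale]
  exact hunit.smul _

-- The resolvent at `z` is `R (1 - (z + μ) R)⁻¹`.
theorem mem_resolventSet_of_not_isEigenvalue (h : IsCompactResolvent A μ R) {z : ℂ}
    (hz : ¬ IsEigenvalue A z) : z ∈ resolventSet A := by
  obtain ⟨U, hU⟩ := h.isUnit_one_sub_smul hz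
  have hUapply : ∀ g, (U : H →L[ℂ] H) g = g - (z + μ) • R g := fun g => by rw [hU]; rfl
  have hcomm : Commute R (↑U⁻¹ : H →L[ℂ] H) :=
    Commute.units_inv_right (hU ▸ (Commute.one_right R).sub_right ((Commute.refl R).smul_right _))
  refine ⟨R * (↑U⁻¹ : H →L[ℂ] H), fun f => ?_, fun g => ⟨h.apply_mem_domain _, ?_⟩⟩
  · have hRf : R (A f - z • (f : H)) = (U : H →L[ℂ] H) f := by
      have hsplit : A f - z • (f : H) = shift A μ f - (z + μ) • (f : H) := by
        rw [shift_apply, add_smul]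
        abel
      rw [hsplit, map_sub, map_smul, h.apply_shift, hUapply]
    rw [hcomm.eq]
    change (↑U⁻¹ : H →L[ℂ] H) (R _) = _
    rw [hRf]
    exact DFunLike.congr_fun U.inv_mul (f : H)
  · set k : H := (↑U⁻¹ : H →L[ℂ] H) g
    have hAk : A ⟨R k, h.apply_mem_domain k⟩ - z • R k = (U : H →L[ℂ] H) k := by
      rw [h.map_apply, hUapply, add_smul]
      abel
    exact hAk.trans (DFunLike.congr_fun U.mul_inv g)

theorem isEigenvalue_of_mem_spectrum (h : IsCompactResolvent A μ R) {z : ℂ}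
    (hz : z ∈ spectrum A) : IsEigenvalue A z :=
  not_imp_comm.1 h.mem_resolventSet_of_not_isEigenvalue hz

theorem spectrum_subset (h : IsCompactResolvent A μ R) :
    spectrum A ⊆ (fun x : ℝ => (x : ℂ)) '' Set.Ici (1 - μ) := by
  intro z hz
  have heig := h.isEigenvalue_of_mem_spectrum hz
  exact ⟨z.re, h.isBoundedBelowBy.le_re_of_isEigenvalue heig,
    Complex.ext rfl (im_eq_zero_of_isEigenvalue h.isFormalAdjoint heig).symm⟩

theorem finite_spectrum_inter_ball (h : IsCompactResolvent A μ R) (z : ℂ) (r : ℝ) :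
    (spectrum A ∩ Metric.ball z r).Finite := by
  rcases le_or_gt r 0 with hr | hr
  · simp [Metric.ball_eq_empty.2 hr]
  have hinj : Function.Injective fun w : ℂ => (w + μ)⁻¹ :=
    inv_injective.comp (add_left_injective _)
  have hpos : 0 < ‖z + μ‖ + r := by positivity
  refine ((finite_setOf_hasEigenvalue_of_le_norm h.compact h.symmetric
    (inv_pos.2 hpos)).preimage hinj.injOn).subset ?_
  rintro w ⟨hw, hwz⟩
  have heig := h.isEigenvalue_of_mem_spectrum hw
  have h0 := h.add_ne_zero_of_isEigenvalue heig
  refine ⟨?_, (h.isEigenvalue_iff h0).1 heig⟩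
  rw [norm_inv]
  refine inv_anti₀ (norm_pos_iff.2 h0) ?_
  calc ‖w + μ‖ = ‖(z + μ) + (w - z)‖ := by ring_nf
    _ ≤ ‖z + μ‖ + ‖w - z‖ := norm_add_le _ _
    _ ≤ ‖z + μ‖ + r := by gcongr; exact (mem_ball_iff_norm.1 hwz).le

theorem not_accPt (h : IsCompactResolvent A μ R) (z : ℂ) :
    ¬ AccPt z (Filter.principal (spectrum A)) := by
  intro hacc
  have hinf := Set.Infinite.of_accPt (hacc.nhds_inter (Metric.ball_mem_nhds z one_pos))
  rw [Set.inter_comm] at hinf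
  exact hinf (h.finite_spectrum_inter_ball z 1)

theorem hasPurelyDiscreteSpectrum (h : IsCompactResolvent A μ R) :
    HasPurelyDiscreteSpectrum A := by
  intro z hz
  have heig := h.isEigenvalue_of_mem_spectrum hz
  have h0 := h.add_ne_zero_of_isEigenvalue heig
  refine ⟨h.not_accPt z, heig, ?_⟩
  rw [h.eigenspace_eq h0]
  exact ContinuousLinearMap.finite_dimensional_eigenspace h.compact _ (inv_ne_zero h0)

variable [Nontrivial H]

theorem isEigenvalue_inv_norm_sub (h : IsCompactResolvent A μ R) :
    IsEigenvalue A ((‖R‖⁻¹ - μ : ℝ) : ℂ) := by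
  have hshift : ((‖R‖⁻¹ - μ : ℝ) : ℂ) + μ = (‖R‖ : ℂ)⁻¹ := by push_cast; ring
  have hne : (‖R‖ : ℂ)⁻¹ ≠ 0 := by simpa using h.ne_zero
  rw [h.isEigenvalue_iff (hshift ▸ hne), hshift, inv_inv]
  exact hasEigenvalue_norm_of_isPositive h.isPositive h.compact h.ne_zero

theorem isLeast_isEigenvalue (h : IsCompactResolvent A μ R) :
    IsLeast {ν : ℝ | IsEigenvalue A (ν : ℂ)} (‖R‖⁻¹ - μ) :=
  ⟨h.isEigenvalue_inv_norm_sub, fun _ hν =>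
    h.isBoundedBelowBy_inv_norm_sub.le_re_of_isEigenvalue hν⟩

end IsCompactResolvent

end CompactResolvent

section Closure

variable {H : Type*} [NormedAddCommGroup H] [InnerProductSpace ℂ H] {A : H →ₗ.[ℂ] H} {μ : ℝ}

theorem isClosable_of_isFormalAdjoint [CompleteSpace H] (hdense : Dense (A.domain : Set H))
    (hA : A.IsFormalAdjoint A) : A.IsClosable :=
  (LinearPMap.adjoint_isClosed hdense).isClosable.leIsClosable
    (LinearPMap.IsFormalAdjoint.le_adjoint hdense hA)

theorem closure_induction (hA : A.IsClosable) {P : H → H → Prop}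
    (hP : IsClosed {q : H × H | P q.1 q.2}) (h : ∀ f : A.domain, P f (A f))
    (f : A.closure.domain) : P f (A.closure f) := by
  have hmem := A.closure.mem_graph f
  rw [← hA.graph_closure_eq_closure_graph] at hmem
  refine closure_minimal (s := (A.graph : Set (H × H))) ?_ hP hmem
  rintro ⟨a, b⟩ hab
  obtain ⟨y, rfl, rfl⟩ := (LinearPMap.mem_graph_iff A).1 hab
  exact h y

theorem isFormalAdjoint_closure (hA : A.IsClosable) (hsymm : A.IsFormalAdjoint A) :
    A.closure.IsFormalAdjoint A.closure := by
  have hmixed : ∀ (f : A.domain) (g : A.closure.domain),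
      inner ℂ (A f) (g : H) = inner ℂ (f : H) (A.closure g) := fun f =>
    closure_induction hA (P := fun a b => inner ℂ (A f) a = inner ℂ (f : H) b)
      (isClosed_eq (by fun_prop) (by fun_prop)) (hsymm f)
  intro f g
  exact closure_induction hA (P := fun a b => inner ℂ b (g : H) = inner ℂ a (A.closure g))
    (isClosed_eq (by fun_prop) (by fun_prop)) (fun f => hmixed f g) f

theorem IsBoundedBelowBy.closure {c : ℝ} (hc : IsBoundedBelowBy A c) (hA : A.IsClosable) :
    IsBoundedBelowBy A.closure c :=
  closure_induction hA (P := fun a b => c * ‖a‖ ^ 2 ≤ (inner ℂ a b).re)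
    (isClosed_le (by fun_prop) (Complex.continuous_re.comp (by fun_prop))) hc

theorem IsBoundedBelowBy.norm_sq_le_re_inner_shift (hA : IsBoundedBelowBy A (1 - μ))
    (f : A.domain) : ‖(f : H)‖ ^ 2 ≤ (inner ℂ (f : H) (shift A μ f)).re := by
  rw [re_inner_shift]
  linarith [hA f]

theorem IsBoundedBelowBy.norm_le_norm_shift (hA : IsBoundedBelowBy A (1 - μ)) (f : A.domain) :
    ‖(f : H)‖ ≤ ‖shift A μ f‖ := by
  have hsq : ‖(f : H)‖ * ‖(f : H)‖ ≤ ‖(f : H)‖ * ‖shift A μ f‖ :=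
    calc ‖(f : H)‖ * ‖(f : H)‖ = ‖(f : H)‖ ^ 2 := (sq _).symm
      _ ≤ (inner ℂ (f : H) (shift A μ f)).re := hA.norm_sq_le_re_inner_shift f
      _ ≤ ‖(f : H)‖ * ‖shift A μ f‖ := re_inner_le_norm (𝕜 := ℂ) _ _
  rcases (norm_nonneg (f : H)).eq_or_lt with h0 | hpos
  · rw [← h0]
    exact norm_nonneg _
  · exact le_of_mul_le_mul_left hsq hpos

theorem IsBoundedBelowBy.shift_injective (hA : IsBoundedBelowBy A (1 - μ)) :
    Function.Injective (shift A μ) := by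
  refine (injective_iff_map_eq_zero _).2 fun f hf => ?_
  have hle := hA.norm_le_norm_shift f
  rw [hf, norm_zero] at hle
  exact Subtype.ext (norm_le_zero_iff.1 hle)

-- `A + μ` is bounded, and bounded from below, as an operator on the complete space `graph A`.
theorem IsBoundedBelowBy.isClosed_range_shift [CompleteSpace H] (hclosed : A.IsClosed)
    (hA : IsBoundedBelowBy A (1 - μ)) : IsClosed (Set.range (shift A μ)) := by
  have : CompleteSpace A.graph := IsClosed.completeSpace_coe (hs := hclosed)
  let Φ : A.graph →L[ℂ] H :=
    (ContinuousLinearMap.snd ℂ H H + (μ : ℂ) • ContinuousLinearMap.fst ℂ H H) ∘L A.graph.subtypeL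
  have hrange : Set.range Φ = Set.range (shift A μ) := by
    ext g
    constructor
    · rintro ⟨⟨⟨a, b⟩, hab⟩, rfl⟩
      obtain ⟨f, rfl, rfl⟩ := (LinearPMap.mem_graph_iff A).1 hab
      exact ⟨f, rfl⟩
    · rintro ⟨f, rfl⟩
      exact ⟨⟨_, A.mem_graph f⟩, rfl⟩
  have hbound : ∀ q, ‖q‖ ≤ (1 + ‖μ‖₊ : NNReal) * ‖Φ q‖ := by
    rintro ⟨⟨a, b⟩, hab⟩
    obtain ⟨f, rfl, rfl⟩ := (LinearPMap.mem_graph_iff A).1 hab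
    change max ‖(f : H)‖ ‖A f‖ ≤ (1 + |μ|) * ‖shift A μ f‖
    have hf := hA.norm_le_norm_shift f
    have hAf : ‖A f‖ ≤ ‖shift A μ f‖ + |μ| * ‖(f : H)‖ :=
      calc ‖A f‖ = ‖shift A μ f - (μ : ℂ) • (f : H)‖ := by rw [shift_apply, add_sub_cancel_right]
        _ ≤ ‖shift A μ f‖ + |μ| * ‖(f : H)‖ := (norm_sub_le _ _).trans_eq (by simp [norm_smul])
    have hmul : |μ| * ‖(f : H)‖ ≤ |μ| * ‖shift A μ f‖ := by gcongr
    rw [add_mul, one_mul]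
    refine max_le ?_ (by linarith)
    linarith [mul_nonneg (abs_nonneg μ) (norm_nonneg (shift A μ f))]
  rw [← hrange]
  exact (Φ.antilipschitz_of_bound hbound).isClosed_range Φ.uniformContinuous

theorem denseRange_shift_closure (h : DenseRange (shift A μ)) :
    DenseRange (shift A.closure μ) := by
  refine h.mono ?_
  rintro _ ⟨f, rfl⟩
  refine ⟨⟨f, A.le_closure.1 f.2⟩, ?_⟩
  rw [shift_apply, shift_apply, A.le_closure.2 (y := ⟨f, A.le_closure.1 f.2⟩) rfl]

theorem denseRange_shift [CompleteSpace H]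
    (h : ∀ u : H, (∀ f : A.domain, inner ℂ u (shift A μ f) = 0) → u = 0) :
    DenseRange (shift A μ) := by
  change Dense ((LinearMap.range (shift A μ) : Submodule ℂ H) : Set H)
  rw [Submodule.dense_iff_topologicalClosure_eq_top, Submodule.topologicalClosure_eq_top_iff,
    Submodule.eq_bot_iff]
  exact fun u hu => h u fun f => (Submodule.mem_orthogonal' _ _).1 hu _ ⟨f, rfl⟩

/-- The embedding of the form domain of `A + μ` into the Hilbert space is compact: up to finitely
many coordinates, the norm is arbitrarily small compared with the form of `A + μ`. -/
def HasCompactForm (A : H →ₗ.[ℂ] H) (μ : ℝ) : Prop :=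
  ∀ ε > 0, ∃ (N : ℕ) (T : H →L[ℂ] (Fin N → ℂ)), ∀ f : A.domain,
    ‖(f : H)‖ ^ 2 ≤ ε * (inner ℂ (f : H) (shift A μ f)).re + ‖T f‖ ^ 2

theorem HasCompactForm.closure (h : HasCompactForm A μ) (hA : A.IsClosable) :
    HasCompactForm A.closure μ := by
  intro ε hε
  obtain ⟨N, T, hT⟩ := h ε hε
  refine ⟨N, T, closure_induction hA (P := fun a b =>
    ‖a‖ ^ 2 ≤ ε * (inner ℂ a (b + (μ : ℂ) • a)).re + ‖T a‖ ^ 2) ?_ hT⟩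
  refine isClosed_le (by fun_prop) (.add (continuous_const.mul ?_) (by fun_prop))
  exact Complex.continuous_re.comp (by fun_prop)

theorem HasCompactForm.isCompactOperator [CompleteSpace H] (h : HasCompactForm A μ)
    {R : H →L[ℂ] H} (hR : ∀ g, ∃ f : A.domain, R g = f ∧ shift A μ f = g)
    (hnorm : ∀ g, ‖R g‖ ≤ ‖g‖) : IsCompactOperator R := by
  refine isCompactOperator_of_forall_norm_le_add fun ε hε => ?_
  obtain ⟨N, T, hT⟩ := h (ε ^ 2) (by positivity)
  refine ⟨N, T ∘L R, fun g => le_of_sq_le_sq ?_ (by positivity)⟩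
  obtain ⟨f, hf, hfg⟩ := hR g
  have hTf := hT f
  rw [← hf, hfg] at hTf
  have hinner : (inner ℂ (R g) g).re ≤ ‖g‖ ^ 2 :=
    calc (inner ℂ (R g) g).re ≤ ‖R g‖ * ‖g‖ := re_inner_le_norm (𝕜 := ℂ) _ _
      _ ≤ ‖g‖ * ‖g‖ := by gcongr; exact hnorm g
      _ = ‖g‖ ^ 2 := (sq _).symm
  calc ‖R g‖ ^ 2 ≤ ε ^ 2 * (inner ℂ (R g) g).re + ‖T (R g)‖ ^ 2 := hTf
    _ ≤ ε ^ 2 * ‖g‖ ^ 2 + ‖T (R g)‖ ^ 2 := by gcongr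
    _ ≤ (ε * ‖g‖ + ‖(T ∘L R) g‖) ^ 2 := by
      change _ ≤ (ε * ‖g‖ + ‖T (R g)‖) ^ 2
      nlinarith [mul_nonneg (mul_nonneg hε.le (norm_nonneg g)) (norm_nonneg (T (R g)))]

theorem exists_isCompactResolvent_of_isClosed [CompleteSpace H] (hclosed : A.IsClosed)
    (hsymm : A.IsFormalAdjoint A) (hlower : IsBoundedBelowBy A (1 - μ))
    (hdense : DenseRange (shift A μ)) (hcompact : HasCompactForm A μ) :
    ∃ R : H →L[ℂ] H, IsCompactResolvent A μ R := by
  have hsurj : Function.Surjective (shift A μ) := by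
    rw [← Set.range_eq_univ, ← (hlower.isClosed_range_shift hclosed).closure_eq,
      hdense.closure_range]
  let e := LinearEquiv.ofBijective (shift A μ) ⟨hlower.shift_injective, hsurj⟩
  have hshift : ∀ g, shift A μ (e.symm g) = g := e.apply_symm_apply
  have hnorm : ∀ g, ‖(e.symm g : H)‖ ≤ ‖g‖ := fun g => by
    simpa only [hshift] using hlower.norm_le_norm_shift (e.symm g)
  let R : H →L[ℂ] H := (A.domain.subtype ∘ₗ e.symm.toLinearMap).mkContinuous 1 fun g => by
    simpa using hnorm g
  have hRapply : ∀ g, R g = e.symm g := fun _ => rfl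
  have hcomp : IsCompactOperator R :=
    hcompact.isCompactOperator (fun g => ⟨e.symm g, rfl, hshift g⟩) hnorm
  refine ⟨R, fun f g => ⟨fun hfg => ?_, fun hfg => ?_⟩, hcomp, fun f g => ?_, fun g => ?_⟩
  · obtain ⟨y, rfl, rfl⟩ := (LinearPMap.mem_graph_iff A).1 hfg
    exact congrArg Subtype.val (e.symm_apply_apply y)
  · have hAf : A (e.symm (g + (μ : ℂ) • f)) = g := by
      have hs := hshift (g + (μ : ℂ) • f)
      rwa [shift_apply, ← hRapply, hfg, add_left_inj] at hs
    exact (LinearPMap.mem_graph_iff A).2 ⟨e.symm (g + (μ : ℂ) • f), hfg, hAf⟩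
  · have hfg := hsymm (e.symm f) (e.symm g)
    have hexpand : inner ℂ (shift A μ (e.symm f)) (R g) = inner ℂ (R f) (shift A μ (e.symm g)) := by
      rw [shift_apply, shift_apply, inner_add_left, inner_add_right, inner_smul_left,
        inner_smul_right, Complex.conj_ofReal, hRapply, hRapply, hfg]
    rwa [hshift, hshift, eq_comm] at hexpand
  · have hg := hlower.norm_sq_le_re_inner_shift (e.symm g)
    rwa [hshift] at hg

theorem exists_isCompactResolvent_closure [CompleteSpace H] (hdomain : Dense (A.domain : Set H))
    (hsymm : A.IsFormalAdjoint A) (hlower : IsBoundedBelowBy A (1 - μ))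
    (hdense : DenseRange (shift A μ)) (hcompact : HasCompactForm A μ) :
    ∃ R : H →L[ℂ] H, IsCompactResolvent A.closure μ R :=
  have hA := isClosable_of_isFormalAdjoint hdomain hsymm
  exists_isCompactResolvent_of_isClosed hA.closure_isClosed (isFormalAdjoint_closure hA hsymm)
    (hlower.closure hA) (denseRange_shift_closure hdense) (hcompact.closure hA)

end Closure

section Calculus

variable {E F ι : Type*} [NormedAddCommGroup E] [NormedAddCommGroup F] [NormedSpace ℝ F] [Fintype ι]

theorem contDiff_fderiv_apply [NormedSpace ℝ E] {f : E → F} (hf : ContDiff ℝ ∞ f) (v : E) :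
    ContDiff ℝ ∞ fun x => fderiv ℝ f x v :=
  (hf.fderiv_right (m := ∞) (by simp)).clm_apply contDiff_const

theorem fderiv_conj_apply [NormedSpace ℝ E] {ψ : E → ℂ} {x : E} (hψ : DifferentiableAt ℝ ψ x)
    (v : E) : fderiv ℝ (fun y => conj (ψ y)) x v = conj (fderiv ℝ ψ x v) :=
  congrArg (· v) (Complex.conjCLE.hasFDerivAt.comp x hψ.hasFDerivAt).fderiv

variable [InnerProductSpace ℝ E]

theorem laplacian_eq_sum [FiniteDimensional ℝ E] (b : OrthonormalBasis ι ℝ E) {f : E → F}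
    (hf : ContDiff ℝ ∞ f) (x : E) :
    Δ f x = ∑ i, fderiv ℝ (fun y => fderiv ℝ f y (b i)) x (b i) := by
  have hdiff : DifferentiableAt ℝ (fderiv ℝ f) x :=
    (hf.fderiv_right (m := ∞) (by simp)).differentiable (by simp) x
  rw [InnerProductSpace.laplacian_eq_iteratedFDeriv_orthonormalBasis f b]
  refine Finset.sum_congr rfl fun i _ => ?_
  rw [iteratedFDeriv_two_apply, fderiv_clm_apply hdiff (by fun_prop)]
  simp

theorem continuous_laplacian [FiniteDimensional ℝ E] {f : E → F} (hf : ContDiff ℝ ∞ f) :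
    Continuous (Δ f) := by
  rw [funext (laplacian_eq_sum (stdOrthonormalBasis ℝ E) hf)]
  exact continuous_finsetSum _ fun i _ =>
    (contDiff_fderiv_apply (contDiff_fderiv_apply hf _) _).continuous

theorem hasCompactSupport_laplacian [FiniteDimensional ℝ E] {f : E → F} (hf : ContDiff ℝ ∞ f)
    (hc : HasCompactSupport f) : HasCompactSupport (Δ f) := by
  refine hc.mono' fun x hx => by_contra fun hxf => hx ?_
  rw [laplacian_eq_sum (stdOrthonormalBasis ℝ E) hf]
  refine Finset.sum_eq_zero fun i _ => ?_
  rw [fderiv_of_notMem_tsupport ℝ fun hxi => hxf (tsupport_fderiv_apply_subset ℝ _ hxi)]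
  rfl

/-- The squared length of the gradient of `f`, computed in an orthonormal basis. -/
def gradSq (b : OrthonormalBasis ι ℝ E) (f : E → F) (x : E) : ℝ :=
  ∑ i, ‖fderiv ℝ f x (b i)‖ ^ 2

theorem gradSq_nonneg (b : OrthonormalBasis ι ℝ E) (f : E → F) (x : E) : 0 ≤ gradSq b f x :=
  Finset.sum_nonneg fun _ _ => by positivity

theorem continuous_gradSq (b : OrthonormalBasis ι ℝ E) {f : E → F} (hf : ContDiff ℝ ∞ f) :
    Continuous (gradSq b f) :=
  continuous_finsetSum _ fun i _ => (contDiff_fderiv_apply hf (b i)).continuous.norm.pow 2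

theorem hasCompactSupport_gradSq (b : OrthonormalBasis ι ℝ E) {f : E → F}
    (hc : HasCompactSupport f) : HasCompactSupport (gradSq b f) :=
  hc.mono' fun x hx => by_contra fun hxf => hx <| by
    simp [gradSq, fderiv_of_notMem_tsupport ℝ hxf]

variable [FiniteDimensional ℝ E] {V : E → ℝ} {ψ : E → ℂ}

theorem continuous_expr (hV : Continuous V) (hψ : ContDiff ℝ ∞ ψ) : Continuous (expr V ψ) :=
  (continuous_laplacian hψ).neg.add ((Complex.continuous_ofReal.comp hV).mul hψ.continuous)

theorem hasCompactSupport_expr (hψ : ContDiff ℝ ∞ ψ) (hc : HasCompactSupport ψ) :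
    HasCompactSupport (expr V ψ) :=
  (hasCompactSupport_laplacian hψ hc).neg.add (hc.mul_left (f := fun x => (V x : ℂ)))

end Calculus

section Green

variable {E F ι : Type*} [NormedAddCommGroup E] [NormedAddCommGroup F] [InnerProductSpace ℝ E]
  [FiniteDimensional ℝ E] [MeasurableSpace E] [BorelSpace E] [Fintype ι] {V : E → ℝ} {ψ φ : E → ℂ}

theorem integrable_conj_mul (hψ : Continuous ψ) (hφ : Continuous φ) (hc : HasCompactSupport ψ) :
    Integrable fun x => conj (ψ x) * φ x :=
  Continuous.integrable_of_hasCompactSupport (by fun_prop)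
    (HasCompactSupport.mul_right (hc.comp_left (map_zero (starRingEnd ℂ))))

theorem integrable_mul_norm_sq {f : E → F} (hV : Continuous V) (hf : Continuous f)
    (hc : HasCompactSupport f) : Integrable fun x => V x * ‖f x‖ ^ 2 :=
  Continuous.integrable_of_hasCompactSupport (by fun_prop)
    (HasCompactSupport.mul_left (hc.comp_left (g := fun z => ‖z‖ ^ 2) (by simp)))

theorem integrable_norm_sq {f : E → F} (hf : Continuous f) (hc : HasCompactSupport f) :
    Integrable fun x => ‖f x‖ ^ 2 := by
  simpa only [one_mul] using integrable_mul_norm_sq (V := fun _ => 1) continuous_const hf hc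

theorem integrable_gradSq [NormedSpace ℝ F] (b : OrthonormalBasis ι ℝ E) {f : E → F}
    (hf : ContDiff ℝ ∞ f) (hc : HasCompactSupport f) : Integrable (gradSq b f) :=
  (continuous_gradSq b hf).integrable_of_hasCompactSupport (hasCompactSupport_gradSq b hc)

theorem integral_conj_mul_fderiv_fderiv (hψ : ContDiff ℝ ∞ ψ) (hc : HasCompactSupport ψ)
    (hφ : ContDiff ℝ ∞ φ) (v : E) :
    ∫ x, conj (ψ x) * fderiv ℝ (fun y => fderiv ℝ φ y v) x v
      = -∫ x, conj (fderiv ℝ ψ x v) * fderiv ℝ φ x v := by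
  have hψd := hψ.differentiable (by simp)
  have hDφ := contDiff_fderiv_apply hφ v
  rw [integral_mul_fderiv_eq_neg_fderiv_mul_of_integrable]
  · simp_rw [fderiv_conj_apply (hψd _)]
  · simp_rw [fderiv_conj_apply (hψd _)]
    exact integrable_conj_mul (contDiff_fderiv_apply hψ v).continuous hDφ.continuous
      (hc.fderiv_apply (𝕜 := ℝ) v)
  · exact integrable_conj_mul hψ.continuous (contDiff_fderiv_apply hDφ v).continuous hc
  · exact integrable_conj_mul hψ.continuous hDφ.continuous hc
  · exact fun x _ => Complex.conjCLE.differentiableAt.comp x (hψd x)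
  · exact fun x _ => hDφ.differentiable (by simp) x

theorem integral_conj_mul_neg_laplacian (b : OrthonormalBasis ι ℝ E) (hψ : ContDiff ℝ ∞ ψ)
    (hc : HasCompactSupport ψ) (hφ : ContDiff ℝ ∞ φ) :
    ∫ x, conj (ψ x) * -(Δ φ) x
      = ∑ i, ∫ x, conj (fderiv ℝ ψ x (b i)) * fderiv ℝ φ x (b i) := by
  simp_rw [laplacian_eq_sum b hφ, mul_neg, Finset.mul_sum]
  rw [integral_neg, integral_finsetSum, ← Finset.sum_neg_distrib]
  · simp_rw [integral_conj_mul_fderiv_fderiv hψ hc hφ, neg_neg]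
  · exact fun i _ => integrable_conj_mul hψ.continuous
      (contDiff_fderiv_apply (contDiff_fderiv_apply hφ _) _).continuous hc

theorem integrable_conj_mul_potential (hV : Continuous V) (hψ : Continuous ψ)
    (hc : HasCompactSupport ψ) (hφ : Continuous φ) :
    Integrable fun x => conj (ψ x) * ((V x : ℂ) * φ x) :=
  integrable_conj_mul hψ (by fun_prop) hc

theorem integral_conj_mul_expr (b : OrthonormalBasis ι ℝ E) (hV : Continuous V)
    (hψ : ContDiff ℝ ∞ ψ) (hc : HasCompactSupport ψ) (hφ : ContDiff ℝ ∞ φ) :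
    ∫ x, conj (ψ x) * expr V φ x
      = (∑ i, ∫ x, conj (fderiv ℝ ψ x (b i)) * fderiv ℝ φ x (b i))
        + ∫ x, conj (ψ x) * ((V x : ℂ) * φ x) := by
  simp only [expr, mul_add]
  rw [← integral_conj_mul_neg_laplacian b hψ hc hφ, integral_add]
  · exact integrable_conj_mul hψ.continuous (continuous_laplacian hφ).neg hc
  · exact integrable_conj_mul_potential hV hψ.continuous hc hφ.continuous

theorem re_integral_conj_mul_expr (b : OrthonormalBasis ι ℝ E) (hV : Continuous V)
    (hψ : ContDiff ℝ ∞ ψ) (hc : HasCompactSupport ψ) (hφ : ContDiff ℝ ∞ φ) :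
    (∫ x, conj (ψ x) * expr V φ x).re
      = ∫ x, (∑ i, (conj (fderiv ℝ ψ x (b i)) * fderiv ℝ φ x (b i)).re
        + V x * (conj (ψ x) * φ x).re) := by
  have hgrad : ∀ i, Integrable fun x => conj (fderiv ℝ ψ x (b i)) * fderiv ℝ φ x (b i) := fun i =>
    integrable_conj_mul (contDiff_fderiv_apply hψ _).continuous
      (contDiff_fderiv_apply hφ _).continuous (hc.fderiv_apply (𝕜 := ℝ) _)
  have hsum := integrable_finsetSum Finset.univ fun i _ => hgrad i
  have hpot := integrable_conj_mul_potential hV hψ.continuous hc hφ.continuous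
  rw [integral_conj_mul_expr b hV hψ hc hφ, ← integral_finsetSum _ fun i _ => hgrad i,
    ← integral_add hsum hpot]
  refine (integral_re (hsum.add hpot)).symm.trans (integral_congr_ae (.of_forall fun x => ?_))
  change (∑ i, conj (fderiv ℝ ψ x (b i)) * fderiv ℝ φ x (b i)
    + conj (ψ x) * ((V x : ℂ) * φ x)).re = _
  rw [Complex.add_re, Complex.re_sum, mul_left_comm, Complex.re_ofReal_mul]

/-- The quadratic form `ψ ↦ ∫ |∇ψ|² + V|ψ|²` of `-Δ + V`. -/
def energy (b : OrthonormalBasis ι ℝ E) (V : E → ℝ) (ψ : E → ℂ) : ℝ :=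
  ∫ x, (gradSq b ψ x + V x * ‖ψ x‖ ^ 2)

theorem energy_eq (b : OrthonormalBasis ι ℝ E) (hV : Continuous V) (hψ : ContDiff ℝ ∞ ψ)
    (hc : HasCompactSupport ψ) :
    energy b V ψ = (∫ x, gradSq b ψ x) + ∫ x, V x * ‖ψ x‖ ^ 2 :=
  integral_add (integrable_gradSq b hψ hc) (integrable_mul_norm_sq hV hψ.continuous hc)

theorem conj_mul_self_re (z : ℂ) : (conj z * z).re = ‖z‖ ^ 2 := by
  rw [Complex.conj_mul']
  norm_cast

theorem re_integral_conj_mul_expr_self (b : OrthonormalBasis ι ℝ E) (hV : Continuous V)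
    (hψ : ContDiff ℝ ∞ ψ) (hc : HasCompactSupport ψ) :
    (∫ x, conj (ψ x) * expr V ψ x).re = energy b V ψ := by
  simp only [re_integral_conj_mul_expr b hV hψ hc hψ, conj_mul_self_re, energy, gradSq]

theorem integral_conj_expr_mul (hV : Continuous V) (hψ : ContDiff ℝ ∞ ψ)
    (hc : HasCompactSupport ψ) (hφ : ContDiff ℝ ∞ φ) (hcφ : HasCompactSupport φ) :
    ∫ x, conj (expr V ψ x) * φ x = ∫ x, conj (ψ x) * expr V φ x := by
  have hswap := congrArg conj (integral_conj_mul_expr (stdOrthonormalBasis ℝ E) hV hφ hcφ hψ)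
  rw [integral_conj_mul_expr (stdOrthonormalBasis ℝ E) hV hψ hc hφ]
  simp only [map_add, map_sum, ← integral_conj, map_mul, Complex.conj_conj,
    Complex.conj_ofReal] at hswap
  simpa only [mul_comm, mul_left_comm, mul_assoc] using hswap

end Green

section Mollify

open scoped Convolution
open ContinuousLinearMap (lsmul)

theorem sq_integral_mul_le {α : Type*} [MeasurableSpace α] {ν : Measure α} {w g : α → ℝ}
    (hw0 : ∀ x, 0 ≤ w x) (hw : Integrable w ν) (hw1 : ∫ x, w x ∂ν = 1)
    (hg : Integrable (fun x => w x * g x) ν) (hg2 : Integrable (fun x => w x * g x ^ 2) ν) :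
    (∫ x, w x * g x ∂ν) ^ 2 ≤ ∫ x, w x * g x ^ 2 ∂ν := by
  set m := ∫ x, w x * g x ∂ν with hm
  have hvariance : ∫ x, w x * (g x - m) ^ 2 ∂ν = ∫ x, w x * g x ^ 2 ∂ν - m ^ 2 :=
    calc ∫ x, w x * (g x - m) ^ 2 ∂ν
        = ∫ x, (w x * g x ^ 2 - 2 * m * (w x * g x) + m ^ 2 * w x) ∂ν :=
          integral_congr_ae (.of_forall fun x => by ring)
      _ = ∫ x, w x * g x ^ 2 ∂ν - m ^ 2 := by
          rw [integral_add (f := fun x => w x * g x ^ 2 - 2 * m * (w x * g x))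
            (hg2.sub (hg.const_mul _)) (hw.const_mul _), integral_sub hg2 (hg.const_mul _),
            integral_const_mul, integral_const_mul, hw1, ← hm]
          ring
  have hnonneg : 0 ≤ ∫ x, w x * (g x - m) ^ 2 ∂ν :=
    integral_nonneg fun x => mul_nonneg (hw0 x) (sq_nonneg _)
  linarith

variable {E : Type*} [NormedAddCommGroup E]

theorem contDiff_comp_const_sub [NormedSpace ℝ E] {f : E → ℝ} (hf : ContDiff ℝ ∞ f) (x : E) :
    ContDiff ℝ ∞ fun s => (f (x - s) : ℂ) :=
  Complex.ofRealCLM.contDiff.comp (hf.comp (contDiff_const.sub contDiff_id))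

theorem hasCompactSupport_comp_const_sub {f : E → ℝ} (hf : HasCompactSupport f) (x : E) :
    HasCompactSupport fun s => (f (x - s) : ℂ) :=
  (hf.comp_homeomorph (Homeomorph.subLeft x)).comp_left Complex.ofReal_zero

theorem fderiv_comp_const_sub_apply [NormedSpace ℝ E] {f : E → ℝ} (hf : ContDiff ℝ ∞ f)
    (x t v : E) : fderiv ℝ (fun s => (f (x - s) : ℂ)) t v = -((fderiv ℝ f (x - t) v : ℝ) : ℂ) := by
  have hsub : HasFDerivAt (fun s : E => x - s) (-ContinuousLinearMap.id ℝ E) t :=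
    (hasFDerivAt_id t).const_sub x
  have hcomp := Complex.ofRealCLM.hasFDerivAt.comp t
    ((hf.differentiable (by simp) (x - t)).hasFDerivAt.comp t hsub)
  refine (congrArg (· v) hcomp.fderiv).trans ?_
  simp

variable [InnerProductSpace ℝ E] [FiniteDimensional ℝ E]

theorem laplacian_comp_const_sub {f : E → ℝ} (hf : ContDiff ℝ ∞ f) (x t : E) :
    Δ (fun s => (f (x - s) : ℂ)) t = (Δ f (x - t) : ℝ) := by
  let b := stdOrthonormalBasis ℝ E
  rw [laplacian_eq_sum b (contDiff_comp_const_sub hf x), laplacian_eq_sum b hf, Complex.ofReal_sum]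
  refine Finset.sum_congr rfl fun i _ => ?_
  simp_rw [fderiv_comp_const_sub_apply hf]
  rw [fderiv_fun_neg, neg_apply,
    fderiv_comp_const_sub_apply (contDiff_fderiv_apply hf (b i)), neg_neg]

variable [MeasurableSpace E] [BorelSpace E] {F : Type*} [NormedAddCommGroup F]

theorem integrable_comp_sub_smul [NormedSpace ℝ F] {ρ : E → ℝ} (hρ : Continuous ρ)
    (hc : HasCompactSupport ρ) {u : E → F} (hu : LocallyIntegrable u) (x : E) :
    Integrable fun t => ρ (x - t) • u t :=
  (hc.convolutionExists_left (lsmul ℝ ℝ) hρ hu x).integrable_swap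

theorem fderiv_convolution_apply [NormedSpace ℝ F] {ρ : E → ℝ} (hρ : ContDiff ℝ ∞ ρ)
    (hc : HasCompactSupport ρ) {u : E → F} (hu : LocallyIntegrable u) (x v : E) :
    fderiv ℝ (ρ ⋆[lsmul ℝ ℝ, volume] u) x v
      = ((fun t => fderiv ℝ ρ t v) ⋆[lsmul ℝ ℝ, volume] u) x := by
  have hρ1 : ContDiff ℝ 1 ρ := hρ.of_le (by simp)
  rw [← convolution_flip (lsmul ℝ ℝ) (f := ρ), ← convolution_flip (lsmul ℝ ℝ) (g := u),
    (hc.hasFDerivAt_convolution_right (lsmul ℝ ℝ).flip hu hρ1 x).fderiv]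
  exact convolution_precompR_apply _ hu (hc.fderiv ℝ) (hρ1.continuous_fderiv one_ne_zero) _ _

theorem laplacian_convolution [NormedSpace ℝ F] {ρ : E → ℝ} (hρ : ContDiff ℝ ∞ ρ)
    (hc : HasCompactSupport ρ) {u : E → F} (hu : LocallyIntegrable u) (x : E) :
    Δ (ρ ⋆[lsmul ℝ ℝ, volume] u) x = ∫ t, Δ ρ (x - t) • u t := by
  let b := stdOrthonormalBasis ℝ E
  have hDρ : ∀ i, ContDiff ℝ ∞ fun y => fderiv ℝ ρ y (b i) := fun i => contDiff_fderiv_apply hρ _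
  have hDc : ∀ i, HasCompactSupport fun y => fderiv ℝ ρ y (b i) := fun i =>
    hc.fderiv_apply (𝕜 := ℝ) _
  have hsecond : ∀ i, fderiv ℝ (fun y => fderiv ℝ (ρ ⋆[lsmul ℝ ℝ, volume] u) y (b i)) x (b i)
      = ∫ t, fderiv ℝ (fun y => fderiv ℝ ρ y (b i)) (x - t) (b i) • u t := fun i => by
    simp_rw [fderiv_convolution_apply hρ hc hu]
    rw [fderiv_convolution_apply (hDρ i) (hDc i) hu, convolution_eq_swap]
    rfl
  have hsmooth : ContDiff ℝ ∞ (ρ ⋆[lsmul ℝ ℝ, volume] u) :=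
    hc.contDiff_convolution_left (n := (⊤ : ℕ∞)) _ hρ hu
  simp_rw [laplacian_eq_sum b hsmooth, laplacian_eq_sum b hρ, hsecond, Finset.sum_smul]
  exact (integral_finsetSum _ fun i _ => integrable_comp_sub_smul
    (contDiff_fderiv_apply (hDρ i) _).continuous ((hDc i).fderiv_apply (𝕜 := ℝ) _) hu x).symm

/-- Mollification of `u` by the normalised bump function `φ`. -/
def mollify [NormedSpace ℝ F] (φ : ContDiffBump (0 : E)) (u : E → F) : E → F :=
  φ.normed volume ⋆[lsmul ℝ ℝ, volume] u

variable (φ : ContDiffBump (0 : E)) {u : E → F}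

theorem mollify_apply [NormedSpace ℝ F] (u : E → F) (x : E) :
    mollify φ u x = ∫ t, φ.normed volume (x - t) • u t := by
  rw [mollify, convolution_eq_swap]
  rfl

theorem contDiff_mollify [NormedSpace ℝ F] (hu : LocallyIntegrable u) :
    ContDiff ℝ ∞ (mollify φ u) :=
  φ.hasCompactSupport_normed.contDiff_convolution_left (n := (⊤ : ℕ∞)) _ φ.contDiff_normed hu

theorem integrable_bump_sub_smul [NormedSpace ℝ F] (hu : LocallyIntegrable u) (x : E) :
    Integrable fun t => φ.normed volume (x - t) • u t :=
  integrable_comp_sub_smul φ.continuous_normed φ.hasCompactSupport_normed hu x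

theorem integral_bump_sub (x : E) : ∫ t, φ.normed volume (x - t) = 1 := by
  rw [integral_sub_left_eq_self (φ.normed (volume : Measure E)), φ.integral_normed]

theorem norm_mollify_le [NormedSpace ℝ F] (u : E → F) (x : E) :
    ‖mollify φ u x‖ ≤ mollify φ (fun t => ‖u t‖) x := by
  rw [mollify_apply, mollify_apply]
  refine (norm_integral_le_integral_norm _).trans_eq (integral_congr_ae (.of_forall fun t => ?_))
  dsimp only
  rw [norm_smul, Real.norm_of_nonneg (φ.nonneg_normed _), smul_eq_mul]

theorem sq_mollify_norm_le (hu : MemLp u 2) (x : E) :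
    mollify φ (fun t => ‖u t‖) x ^ 2 ≤ mollify φ (fun t => ‖u t‖ ^ 2) x := by
  rw [mollify_apply, mollify_apply]
  exact sq_integral_mul_le (fun t => φ.nonneg_normed _) (φ.integrable_normed.comp_sub_left x)
    (integral_bump_sub φ x)
    (integrable_bump_sub_smul φ (hu.norm.locallyIntegrable one_le_two) x)
    (integrable_bump_sub_smul φ (hu.integrable_norm_pow two_ne_zero).locallyIntegrable x)

theorem integrable_mollify [NormedSpace ℝ F] (hu : Integrable u) : Integrable (mollify φ u) :=
  φ.integrable_normed.integrable_convolution _ hu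

theorem integrable_sq_mollify_norm (hu : MemLp u 2) :
    Integrable fun x => mollify φ (fun t => ‖u t‖) x ^ 2 := by
  refine (integrable_mollify φ (hu.integrable_norm_pow two_ne_zero)).mono'
    ((contDiff_mollify φ (hu.norm.locallyIntegrable one_le_two)).continuous.pow
      2).aestronglyMeasurable (.of_forall fun x => ?_)
  rw [Real.norm_of_nonneg (sq_nonneg _)]
  exact sq_mollify_norm_le φ hu x

theorem integral_sq_mollify_norm_le (hu : MemLp u 2) :
    ∫ x, mollify φ (fun t => ‖u t‖) x ^ 2 ≤ ∫ x, ‖u x‖ ^ 2 := by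
  have hu2 : Integrable fun t => ‖u t‖ ^ 2 := hu.integrable_norm_pow two_ne_zero
  calc ∫ x, mollify φ (fun t => ‖u t‖) x ^ 2 ≤ ∫ x, mollify φ (fun t => ‖u t‖ ^ 2) x :=
        integral_mono (integrable_sq_mollify_norm φ hu) (integrable_mollify φ hu2)
          (sq_mollify_norm_le φ hu)
    _ = ∫ x, ‖u x‖ ^ 2 := by
        rw [mollify, integral_convolution _ φ.integrable_normed hu2, φ.integral_normed]
        simp

/-- `(-Δ + V) u = 0` in the sense of distributions. -/
def IsWeakSolution (V : E → ℝ) (u : E → ℂ) : Prop :=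
  ∀ ψ : E → ℂ, ContDiff ℝ ∞ ψ → HasCompactSupport ψ → ∫ x, conj (u x) * expr V ψ x = 0

variable {V : E → ℝ} {u : E → ℂ}

theorem IsWeakSolution.integral_laplacian_smul (h : IsWeakSolution V u) (hV : Continuous V)
    (hu : LocallyIntegrable u) {ρ : E → ℝ} (hρ : ContDiff ℝ ∞ ρ) (hc : HasCompactSupport ρ)
    (x : E) : ∫ t, Δ ρ (x - t) • u t = ∫ t, ρ (x - t) • ((V t : ℂ) * u t) := by
  have hVu : LocallyIntegrable fun t => (V t : ℂ) * u t := by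
    simpa only [smul_eq_mul, mul_comm] using
      hu.smul_continuous (f := u) (g := fun t => (V t : ℂ)) (by fun_prop)
  have hconj : ∀ t, conj (conj (u t) * expr V (fun s => (ρ (x - s) : ℂ)) t)
      = ρ (x - t) • ((V t : ℂ) * u t) - Δ ρ (x - t) • u t := fun t => by
    rw [expr, laplacian_comp_const_sub hρ]
    simp only [map_mul, map_add, map_neg, Complex.conj_conj, Complex.conj_ofReal,
      Complex.real_smul]
    ring
  have htest := congrArg conj
    (h _ (contDiff_comp_const_sub hρ x) (hasCompactSupport_comp_const_sub hc x))
  rw [← integral_conj, map_zero] at htest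
  simp_rw [hconj] at htest
  rw [integral_sub (integrable_comp_sub_smul hρ.continuous hc hVu x) (integrable_comp_sub_smul
    (continuous_laplacian hρ) (hasCompactSupport_laplacian hρ hc) hu x)] at htest
  exact (sub_eq_zero.1 htest).symm

-- The right-hand side is the commutator of `V` with the mollification, applied to `u`.
theorem IsWeakSolution.expr_mollify (h : IsWeakSolution V u) (hV : Continuous V)
    (hu : LocallyIntegrable u) (x : E) :
    expr V (mollify φ u) x = ∫ t, φ.normed volume (x - t) • (((V x - V t : ℝ) : ℂ) * u t) := by
  have hVu : LocallyIntegrable fun t => (V t : ℂ) * u t := by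
    simpa only [smul_eq_mul, mul_comm] using
      hu.smul_continuous (f := u) (g := fun t => (V t : ℂ)) (by fun_prop)
  have hΔ : Δ (mollify φ u) x = ∫ t, φ.normed volume (x - t) • ((V t : ℂ) * u t) := by
    rw [mollify, laplacian_convolution φ.contDiff_normed φ.hasCompactSupport_normed hu,
      h.integral_laplacian_smul hV hu φ.contDiff_normed φ.hasCompactSupport_normed]
  calc expr V (mollify φ u) x
      = ∫ t, ((V x : ℂ) * (φ.normed volume (x - t) • u t)
          - φ.normed volume (x - t) • ((V t : ℂ) * u t)) := by
        rw [integral_sub ((integrable_bump_sub_smul φ hu x).const_mul _)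
          (integrable_bump_sub_smul φ hVu x), integral_const_mul, ← mollify_apply, ← hΔ, expr]
        ring
    _ = ∫ t, φ.normed volume (x - t) • (((V x - V t : ℝ) : ℂ) * u t) := by
        refine integral_congr_ae (.of_forall fun t => ?_)
        simp only [Complex.real_smul]
        push_cast
        ring

theorem IsWeakSolution.norm_expr_mollify_le (h : IsWeakSolution V u) (hV : Continuous V)
    (hu : LocallyIntegrable u) {x : E} {c : ℝ}
    (hc : ∀ t, dist t x < φ.rOut → |V x - V t| ≤ c) :
    ‖expr V (mollify φ u) x‖ ≤ c * mollify φ (fun t => ‖u t‖) x := by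
  have hnorm : LocallyIntegrable fun t => ‖u t‖ := fun y => (hu y).norm
  rw [h.expr_mollify φ hV hu, mollify_apply, ← integral_const_mul]
  refine norm_integral_le_of_norm_le ((integrable_bump_sub_smul φ hnorm x).const_mul _)
    (.of_forall fun t => ?_)
  have hφ0 := φ.nonneg_normed (μ := (volume : Measure E)) (x - t)
  rw [norm_smul, norm_mul, Complex.norm_real, Real.norm_of_nonneg hφ0, Real.norm_eq_abs,
    smul_eq_mul]
  by_cases ht : dist t x < φ.rOut
  · calc φ.normed volume (x - t) * (|V x - V t| * ‖u t‖)
        ≤ φ.normed volume (x - t) * (c * ‖u t‖) := by gcongr; exact hc t ht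
      _ = c * (φ.normed volume (x - t) * ‖u t‖) := by ring
  · have hφt : φ.normed (volume : Measure E) (x - t) = 0 := by
      rw [← Function.notMem_support, φ.support_normed_eq, mem_ball_zero_iff]
      rwa [dist_comm, dist_eq_norm] at ht
    simp [hφt]

end Mollify

section Cutoff

variable {E : Type*} [NormedAddCommGroup E] {χ : E → ℝ} {w : E → ℂ}

theorem fderiv_ofReal_mul_apply [NormedSpace ℝ E] (hχ : ContDiff ℝ ∞ χ) (hw : ContDiff ℝ ∞ w)
    (x v : E) :
    fderiv ℝ (fun y => (χ y : ℂ) * w y) x v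
      = (χ x : ℂ) * fderiv ℝ w x v + (fderiv ℝ χ x v : ℂ) * w x := by
  have hχx : HasFDerivAt (fun y => (χ y : ℂ)) (Complex.ofRealCLM ∘L fderiv ℝ χ x) x :=
    Complex.ofRealCLM.hasFDerivAt.comp x (hχ.differentiable (by simp) x).hasFDerivAt
  rw [(hχx.fun_mul (hw.differentiable (by simp) x).hasFDerivAt).fderiv]
  simp [mul_comm]

theorem contDiff_ofReal_mul [NormedSpace ℝ E] (hχ : ContDiff ℝ ∞ χ) (hw : ContDiff ℝ ∞ w) :
    ContDiff ℝ ∞ fun y => (χ y : ℂ) * w y :=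
  (Complex.ofRealCLM.contDiff.comp hχ).mul hw

theorem hasCompactSupport_ofReal_mul (hc : HasCompactSupport χ) (w : E → ℂ) :
    HasCompactSupport fun y => (χ y : ℂ) * w y :=
  (hc.comp_left Complex.ofReal_zero).mul_right

theorem norm_ofReal_mul_sq (a : ℝ) (z : ℂ) : ‖(a : ℂ) * z‖ ^ 2 = a ^ 2 * ‖z‖ ^ 2 := by
  rw [norm_mul, Complex.norm_real, Real.norm_eq_abs, mul_pow, sq_abs]

theorem re_conj_localized_mul (a a' : ℝ) (z z' : ℂ) :
    (conj (((a ^ 2 : ℝ) : ℂ) * z' + ((2 * a * a' : ℝ) : ℂ) * z) * z').re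
      = ‖(a : ℂ) * z' + (a' : ℂ) * z‖ ^ 2 - ‖a'‖ ^ 2 * ‖z‖ ^ 2 := by
  simp only [← Complex.normSq_eq_norm_sq, Complex.normSq_apply, Complex.mul_re, Complex.add_re,
    Complex.add_im, Complex.mul_im, Complex.conj_re, Complex.conj_im, Complex.ofReal_re,
    Complex.ofReal_im, Real.norm_eq_abs, sq_abs]
  ring

variable [InnerProductSpace ℝ E] [FiniteDimensional ℝ E] [MeasurableSpace E] [BorelSpace E]
  {ι : Type*} [Fintype ι] {V : E → ℝ}

theorem energy_ofReal_mul (b : OrthonormalBasis ι ℝ E) (hV : Continuous V)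
    (hχ : ContDiff ℝ ∞ χ) (hc : HasCompactSupport χ) (hw : ContDiff ℝ ∞ w) :
    energy b V (fun x => (χ x : ℂ) * w x)
      = (∫ x, conj (((χ x ^ 2 : ℝ) : ℂ) * w x) * expr V w x).re
        + ∫ x, gradSq b χ x * ‖w x‖ ^ 2 := by
  have hχ2 : ContDiff ℝ ∞ fun x => χ x ^ 2 := hχ.pow 2
  have hc2 : HasCompactSupport fun x => χ x ^ 2 :=
    hc.comp_left (g := fun r => r ^ 2) (zero_pow two_ne_zero)
  have hχw := contDiff_ofReal_mul hχ hw
  have hχwc := hasCompactSupport_ofReal_mul hc w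
  have hderiv_sq : ∀ x v, fderiv ℝ (fun y => χ y ^ 2) x v = 2 * χ x * fderiv ℝ χ x v := by
    intro x v
    rw [((hχ.differentiable (by simp) x).hasFDerivAt.pow 2).fderiv]
    simp
  have hdensity : ∀ x, (∑ i, (conj (fderiv ℝ (fun y => ((χ y ^ 2 : ℝ) : ℂ) * w y) x (b i))
        * fderiv ℝ w x (b i)).re + V x * (conj (((χ x ^ 2 : ℝ) : ℂ) * w x) * w x).re)
      = gradSq b (fun x => (χ x : ℂ) * w x) x + V x * ‖(χ x : ℂ) * w x‖ ^ 2
        - gradSq b χ x * ‖w x‖ ^ 2 := fun x => by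
    simp only [fderiv_ofReal_mul_apply hχ2 hw, fderiv_ofReal_mul_apply hχ hw, hderiv_sq,
      re_conj_localized_mul, gradSq, Finset.sum_sub_distrib, Finset.sum_mul]
    rw [map_mul, Complex.conj_ofReal, mul_assoc, Complex.re_ofReal_mul, conj_mul_self_re,
      norm_ofReal_mul_sq]
    ring
  have henergy : Integrable fun x =>
      gradSq b (fun x => (χ x : ℂ) * w x) x + V x * ‖(χ x : ℂ) * w x‖ ^ 2 :=
    (integrable_gradSq b hχw hχwc).add (integrable_mul_norm_sq hV hχw.continuous hχwc)
  have herror : Integrable fun x => gradSq b χ x * ‖w x‖ ^ 2 :=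
    ((continuous_gradSq b hχ).mul (hw.continuous.norm.pow 2)).integrable_of_hasCompactSupport
      (hasCompactSupport_gradSq b hc).mul_right
  rw [re_integral_conj_mul_expr b hV (contDiff_ofReal_mul hχ2 hw)
    (hasCompactSupport_ofReal_mul hc2 w) hw]
  simp only [hdensity]
  rw [integral_sub henergy herror, energy, sub_add_cancel]

end Cutoff

section WeakSolution

theorem integral_le_of_tendsto_ae {α : Type*} [MeasurableSpace α] {ν : Measure α}
    {f : ℕ → α → ℝ} {g : α → ℝ} {d : ℝ} (hf0 : ∀ n x, 0 ≤ f n x)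
    (hfi : ∀ n, Integrable (f n) ν) (hfg : ∀ᵐ x ∂ν, Tendsto (fun n => f n x) atTop (𝓝 (g x)))
    (hfd : ∀ᶠ n in atTop, ∫ x, f n x ∂ν ≤ d) : ∫ x, g x ∂ν ≤ d := by
  have hg0 : 0 ≤ᵐ[ν] g := hfg.mono fun x hx => ge_of_tendsto' hx fun n => hf0 n x
  have hgm : AEStronglyMeasurable g ν :=
    aestronglyMeasurable_of_tendsto_ae atTop (fun n => (hfi n).aestronglyMeasurable) hfg
  have hd0 : 0 ≤ d := by
    obtain ⟨n, hn⟩ := hfd.exists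
    exact (integral_nonneg (hf0 n)).trans hn
  rw [integral_eq_lintegral_of_nonneg_ae hg0 hgm]
  refine ENNReal.toReal_le_of_le_ofReal hd0 ?_
  calc ∫⁻ x, ENNReal.ofReal (g x) ∂ν
      = ∫⁻ x, liminf (fun n => ENNReal.ofReal (f n x)) atTop ∂ν :=
        lintegral_congr_ae (hfg.mono fun x hx => (ENNReal.tendsto_ofReal hx).liminf_eq.symm)
    _ ≤ liminf (fun n => ∫⁻ x, ENNReal.ofReal (f n x) ∂ν) atTop :=
        lintegral_liminf_le' fun n => (hfi n).aestronglyMeasurable.aemeasurable.ennreal_ofReal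
    _ ≤ liminf (fun _ : ℕ => ENNReal.ofReal d) atTop := liminf_le_liminf <| hfd.mono fun n hn => by
        rw [← ofReal_integral_eq_lintegral_ofReal (hfi n) (.of_forall (hf0 n))]
        exact ENNReal.ofReal_le_ofReal hn
    _ = ENNReal.ofReal d := liminf_const _

variable {E : Type*} [NormedAddCommGroup E]

theorem exists_forall_dist_lt_abs_sub_le [ProperSpace E] {V : E → ℝ} (hV : Continuous V)
    {K : Set E} (hK : IsCompact K) {c : ℝ} (hc : 0 < c) :
    ∃ r > 0, ∀ x ∈ K, ∀ t, dist t x < r → |V x - V t| ≤ c := by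
  have hunif := (hK.cthickening (r := 1)).uniformContinuousOn_of_continuous hV.continuousOn
  obtain ⟨r, hr, hVr⟩ := Metric.uniformContinuousOn_iff.1 hunif c hc
  refine ⟨min r 1, by positivity, fun x hx t ht => ?_⟩
  have hxK : x ∈ Metric.cthickening 1 K := Metric.self_subset_cthickening _ hx
  have htK : t ∈ Metric.cthickening 1 K :=
    Metric.mem_cthickening_of_dist_le t x 1 _ hx (ht.le.trans (min_le_right _ _))
  have hxt := hVr x hxK t htK (by rw [dist_comm]; exact ht.trans_le (min_le_left _ _))
  exact (Real.dist_eq _ _ ▸ hxt).le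

variable [InnerProductSpace ℝ E] [FiniteDimensional ℝ E] {ι : Type*} [Fintype ι]

theorem exists_cutoff (b : OrthonormalBasis ι ℝ E) :
    ∃ (χ : ℕ → E → ℝ) (δ : ℕ → ℝ), (∀ n, ContDiff ℝ ∞ (χ n)) ∧ (∀ n, HasCompactSupport (χ n)) ∧
      (∀ n x, |χ n x| ≤ 1) ∧ (∀ n x, gradSq b (χ n) x ≤ δ n) ∧
      (∀ x, Tendsto (fun n => χ n x) atTop (𝓝 1)) ∧ Tendsto δ atTop (𝓝 0) := by
  let f : ContDiffBump (0 : E) := ⟨1, 2, by norm_num, by norm_num⟩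
  have hf : ContDiff ℝ ∞ f := f.contDiff (n := (⊤ : ℕ∞))
  have hfc : HasCompactSupport f := f.hasCompactSupport
  obtain ⟨M, hM⟩ := (continuous_gradSq b hf).bounded_above_of_compact_support
    (hasCompactSupport_gradSq b hfc)
  let a : ℕ → ℝ := fun n => 1 / ((n : ℝ) + 1)
  have ha0 : ∀ n, 0 < a n := fun n => by positivity
  have ha : Tendsto a atTop (𝓝 0) := tendsto_one_div_add_atTop_nhds_zero_nat
  refine ⟨fun n x => f (a n • x), fun n => a n ^ 2 * M, fun n => ?_, fun n => ?_, fun n x => ?_,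
    fun n x => ?_, fun x => ?_, ?_⟩
  · exact hf.comp (contDiff_const_smul (a n))
  · exact hfc.comp_smul (ha0 n).ne'
  · rw [abs_of_nonneg f.nonneg]
    exact f.le_one
  · have hscale : gradSq b (fun x => f (a n • x)) x = a n ^ 2 * gradSq b f (a n • x) := by
      simp_rw [gradSq, fderiv_comp_smul, Finset.mul_sum, smul_apply, norm_smul,
        mul_pow, Real.norm_eq_abs, sq_abs]
    rw [hscale]
    exact mul_le_mul_of_nonneg_left ((le_abs_self _).trans (hM (a n • x))) (by positivity)
  · have hlim : Tendsto (fun n => f (a n • x)) atTop (𝓝 (f ((0 : ℝ) • x))) :=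
      (f.continuous.tendsto _).comp (ha.smul_const x)
    rwa [zero_smul, f.one_of_mem_closedBall (by simp [f])] at hlim
  · simpa using (ha.pow 2).mul_const M

variable [MeasurableSpace E] [BorelSpace E] {b : OrthonormalBasis ι ℝ E} {V : E → ℝ} {u : E → ℂ}
  {χ : E → ℝ} {δ : ℝ}

theorem exists_contDiffBump_seq_tendsto_mollify (hu : LocallyIntegrable u) :
    ∃ φ : ℕ → ContDiffBump (0 : E), Tendsto (fun n => (φ n).rOut) atTop (𝓝 0) ∧
      ∀ᵐ x, Tendsto (fun n => mollify (φ n) u x) atTop (𝓝 (u x)) := by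
  let φ : ℕ → ContDiffBump (0 : E) := fun n =>
    ⟨1 / ((n : ℝ) + 1) / 2, 1 / ((n : ℝ) + 1), by positivity, half_lt_self (by positivity)⟩
  have hφ : Tendsto (fun n => (φ n).rOut) atTop (𝓝 0) := tendsto_one_div_add_atTop_nhds_zero_nat
  have hratio : ∀ n, (φ n).rOut ≤ 2 * (φ n).rIn := fun n => by
    change 1 / ((n : ℝ) + 1) ≤ 2 * (1 / ((n : ℝ) + 1) / 2)
    linarith
  exact ⟨φ, hφ, ContDiffBump.ae_convolution_tendsto_right_of_locallyIntegrable hφ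
    (.of_forall hratio) hu⟩

theorem IsWeakSolution.re_integral_conj_mul_expr_mollify_le (h : IsWeakSolution V u)
    (hV : Continuous V) (hu : MemLp u 2) (hχ1 : ∀ x, |χ x| ≤ 1) {c : ℝ} (hc0 : 0 ≤ c)
    (φ : ContDiffBump (0 : E)) (hφ : ∀ x ∈ tsupport χ, ∀ t, dist t x < φ.rOut → |V x - V t| ≤ c) :
    (∫ x, conj (((χ x ^ 2 : ℝ) : ℂ) * mollify φ u x) * expr V (mollify φ u) x).re
      ≤ c * ∫ x, ‖u x‖ ^ 2 := by
  have hpoint : ∀ x, ‖conj (((χ x ^ 2 : ℝ) : ℂ) * mollify φ u x) * expr V (mollify φ u) x‖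
      ≤ c * mollify φ (fun t => ‖u t‖) x ^ 2 := fun x => by
    have hle := norm_mollify_le φ u x
    by_cases hx : x ∈ tsupport χ
    · have hexpr := h.norm_expr_mollify_le φ hV (hu.locallyIntegrable one_le_two) (hφ x hx)
      have hχx := pow_le_one₀ (n := 2) (abs_nonneg _) (hχ1 x)
      rw [norm_mul, RCLike.norm_conj, norm_mul, Complex.norm_real, Real.norm_eq_abs, abs_pow]
      calc |χ x| ^ 2 * ‖mollify φ u x‖ * ‖expr V (mollify φ u) x‖
          ≤ 1 * mollify φ (fun t => ‖u t‖) x * (c * mollify φ (fun t => ‖u t‖) x) := by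
            have := (norm_nonneg _).trans hle
            gcongr
        _ = c * mollify φ (fun t => ‖u t‖) x ^ 2 := by ring
    · rw [image_eq_zero_of_notMem_tsupport hx]
      simpa using mul_nonneg hc0 (sq_nonneg _)
  calc (∫ x, conj (((χ x ^ 2 : ℝ) : ℂ) * mollify φ u x) * expr V (mollify φ u) x).re
      ≤ ∫ x, c * mollify φ (fun t => ‖u t‖) x ^ 2 :=
        (Complex.re_le_norm _).trans (norm_integral_le_of_norm_le
          ((integrable_sq_mollify_norm φ hu).const_mul c) (.of_forall hpoint))
    _ ≤ c * ∫ x, ‖u x‖ ^ 2 := by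
        rw [integral_const_mul]
        exact mul_le_mul_of_nonneg_left (integral_sq_mollify_norm_le φ hu) hc0

theorem integral_gradSq_mul_norm_mollify_sq_le (hu : MemLp u 2) (hδ : ∀ x, gradSq b χ x ≤ δ)
    (φ : ContDiffBump (0 : E)) :
    ∫ x, gradSq b χ x * ‖mollify φ u x‖ ^ 2 ≤ δ * ∫ x, ‖u x‖ ^ 2 := by
  have hδ0 : 0 ≤ δ := (gradSq_nonneg b χ 0).trans (hδ 0)
  calc ∫ x, gradSq b χ x * ‖mollify φ u x‖ ^ 2
      ≤ ∫ x, δ * mollify φ (fun t => ‖u t‖) x ^ 2 := by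
        refine integral_mono_of_nonneg
          (.of_forall fun x => mul_nonneg (gradSq_nonneg b χ x) (sq_nonneg _))
          ((integrable_sq_mollify_norm φ hu).const_mul δ) (.of_forall fun x => ?_)
        dsimp only
        gcongr
        exacts [hδ x, norm_mollify_le φ u x]
    _ ≤ δ * ∫ x, ‖u x‖ ^ 2 := by
        rw [integral_const_mul]
        exact mul_le_mul_of_nonneg_left (integral_sq_mollify_norm_le φ hu) hδ0

-- Test `-Δ + V ≥ 1` with `χ` times mollifications of `u`: the localization error is controlled by
-- `|∇χ|²`, and the commutator of `V` with the mollification vanishes in the limit.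
theorem IsWeakSolution.integral_sq_mul_norm_sq_le (h : IsWeakSolution V u) (hV : Continuous V)
    (hone : ∀ ψ : E → ℂ, ContDiff ℝ ∞ ψ → HasCompactSupport ψ →
      ∫ x, ‖ψ x‖ ^ 2 ≤ energy b V ψ)
    (hu : MemLp u 2) (hχ : ContDiff ℝ ∞ χ) (hc : HasCompactSupport χ) (hχ1 : ∀ x, |χ x| ≤ 1)
    (hδ : ∀ x, gradSq b χ x ≤ δ) :
    ∫ x, χ x ^ 2 * ‖u x‖ ^ 2 ≤ δ * ∫ x, ‖u x‖ ^ 2 := by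
  have hul : LocallyIntegrable u := hu.locallyIntegrable one_le_two
  obtain ⟨φ, hφ, hlim⟩ := exists_contDiffBump_seq_tendsto_mollify hul
  have happrox : ∀ c > 0, ∫ x, χ x ^ 2 * ‖u x‖ ^ 2 ≤ c * (∫ x, ‖u x‖ ^ 2) + δ * ∫ x, ‖u x‖ ^ 2 := by
    intro c hcpos
    obtain ⟨r, hr, hVr⟩ := exists_forall_dist_lt_abs_sub_le hV hc.isCompact hcpos
    refine integral_le_of_tendsto_ae (f := fun n x => ‖(χ x : ℂ) * mollify (φ n) u x‖ ^ 2)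
      (fun n x => by positivity) (fun n => ?_) ?_ ?_
    · exact integrable_norm_sq (contDiff_ofReal_mul hχ (contDiff_mollify _ hul)).continuous
        (hasCompactSupport_ofReal_mul hc _)
    · filter_upwards [hlim] with x hx
      rw [← norm_ofReal_mul_sq]
      exact (hx.const_mul (χ x : ℂ)).norm.pow 2
    · filter_upwards [hφ.eventually_lt_const hr] with n hn
      have hw := contDiff_mollify (φ n) hul
      refine (hone _ (contDiff_ofReal_mul hχ hw) (hasCompactSupport_ofReal_mul hc _)).trans ?_
      rw [energy_ofReal_mul b hV hχ hc hw]
      exact add_le_add (h.re_integral_conj_mul_expr_mollify_le hV hu hχ1 hcpos.le (φ n)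
        fun x hx t ht => hVr x hx t (ht.trans hn)) (integral_gradSq_mul_norm_mollify_sq_le hu hδ _)
  have hcont : Tendsto (fun c : ℝ => c * (∫ x, ‖u x‖ ^ 2) + δ * ∫ x, ‖u x‖ ^ 2) (𝓝[>] 0)
      (𝓝 (0 * (∫ x, ‖u x‖ ^ 2) + δ * ∫ x, ‖u x‖ ^ 2)) :=
    (Continuous.tendsto (by fun_prop) 0).mono_left nhdsWithin_le_nhds
  simpa using ge_of_tendsto hcont (eventually_mem_nhdsWithin.mono happrox)

theorem IsWeakSolution.ae_eq_zero (h : IsWeakSolution V u) (hV : Continuous V)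
    (hone : ∀ ψ : E → ℂ, ContDiff ℝ ∞ ψ → HasCompactSupport ψ →
      ∫ x, ‖ψ x‖ ^ 2 ≤ energy b V ψ)
    (hu : MemLp u 2) : u =ᵐ[volume] 0 := by
  obtain ⟨χ, δ, hχ, hc, hχ1, hδ, hlim, hδ0⟩ := exists_cutoff b
  have hu2 : Integrable fun x => ‖u x‖ ^ 2 := hu.integrable_norm_pow two_ne_zero
  have htendsto : Tendsto (fun n => ∫ x, χ n x ^ 2 * ‖u x‖ ^ 2) atTop (𝓝 (∫ x, ‖u x‖ ^ 2)) := by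
    refine tendsto_integral_of_dominated_convergence _ (fun n =>
      ((hχ n).continuous.pow 2).aestronglyMeasurable.mul hu2.aestronglyMeasurable) hu2
      (fun n => .of_forall fun x => ?_) (.of_forall fun x => ?_)
    · rw [Real.norm_of_nonneg (by positivity), ← sq_abs (χ n x)]
      exact mul_le_of_le_one_left (by positivity) (pow_le_one₀ (abs_nonneg _) (hχ1 n x))
    · simpa using ((hlim x).pow 2).mul_const (‖u x‖ ^ 2)
  have hle : ∫ x, ‖u x‖ ^ 2 ≤ 0 := by
    simpa using le_of_tendsto_of_tendsto' htendsto (hδ0.mul_const (∫ x, ‖u x‖ ^ 2)) fun n =>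
      h.integral_sq_mul_norm_sq_le hV hone hu (hχ n) (hc n) (hχ1 n) (hδ n)
  have hzero := (integral_eq_zero_iff_of_nonneg (fun x => by positivity) hu2).1
    (hle.antisymm (integral_nonneg fun x => by positivity))
  filter_upwards [hzero] with x hx
  simpa using hx

end WeakSolution

section MollificationEstimates

theorem sq_integral_le {α : Type*} [MeasurableSpace α] {ν : Measure α} [IsFiniteMeasure ν]
    {g : α → ℝ} (hg : Integrable g ν) (hg2 : Integrable (fun x => g x ^ 2) ν) :
    (∫ x, g x ∂ν) ^ 2 ≤ ν.real Set.univ * ∫ x, g x ^ 2 ∂ν := by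
  rcases eq_zero_or_neZero ν with rfl | _
  · simp
  have hpos : 0 < ν.real Set.univ := measureReal_univ_pos
  have hjensen := (even_two.convexOn_pow (𝕜 := ℝ)).map_average_le (μ := ν) (f := g)
    (continuous_pow 2).continuousOn isClosed_univ (.of_forall fun _ => Set.mem_univ _) hg hg2
  simp_rw [average_eq, smul_eq_mul] at hjensen
  calc (∫ x, g x ∂ν) ^ 2 = ν.real Set.univ ^ 2 * ((ν.real Set.univ)⁻¹ * ∫ x, g x ∂ν) ^ 2 := by
        field_simp
    _ ≤ ν.real Set.univ ^ 2 * ((ν.real Set.univ)⁻¹ * ∫ x, g x ^ 2 ∂ν) := by gcongr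
    _ = ν.real Set.univ * ∫ x, g x ^ 2 ∂ν := by field_simp

variable {E F : Type*} [NormedAddCommGroup E] [NormedAddCommGroup F] [InnerProductSpace ℝ E]
  {ι : Type*} [Fintype ι] {ψ : E → F}

theorem sq_setIntegral_norm_le [FiniteDimensional ℝ E] [MeasurableSpace E] [BorelSpace E]
    (hψ : Continuous ψ) (hc : HasCompactSupport ψ) {S : Set E} (hS : volume S ≠ ⊤) :
    (∫ t in S, ‖ψ t‖) ^ 2 ≤ volume.real S * ∫ t, ‖ψ t‖ ^ 2 := by
  have : IsFiniteMeasure (volume.restrict S) := isFiniteMeasure_restrict.2 hS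
  have hI2 := integrable_norm_sq hψ hc
  calc (∫ t in S, ‖ψ t‖) ^ 2 ≤ volume.real S * ∫ t in S, ‖ψ t‖ ^ 2 := by
        simpa using sq_integral_le
          (hψ.norm.integrable_of_hasCompactSupport hc.norm).integrableOn hI2.integrableOn
    _ ≤ volume.real S * ∫ t, ‖ψ t‖ ^ 2 := by
        gcongr ?_ * ?_
        exact setIntegral_le_integral hI2 (.of_forall fun t => sq_nonneg _)

variable [NormedSpace ℝ F]

theorem norm_fderiv_apply_sq_le (b : OrthonormalBasis ι ℝ E) (ψ : E → F) (x t : E) :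
    ‖fderiv ℝ ψ x t‖ ^ 2 ≤ ‖t‖ ^ 2 * gradSq b ψ x := by
  have hexpand : fderiv ℝ ψ x t = ∑ i, inner ℝ (b i) t • fderiv ℝ ψ x (b i) := by
    conv_lhs => rw [← b.sum_repr' t, map_sum]
    simp_rw [map_smul]
  calc ‖fderiv ℝ ψ x t‖ ^ 2 ≤ (∑ i, ‖inner ℝ (b i) t‖ * ‖fderiv ℝ ψ x (b i)‖) ^ 2 := by
        rw [hexpand]
        simp_rw [← norm_smul]
        gcongr
        exact norm_sum_le _ _
    _ ≤ (∑ i, ‖inner ℝ (b i) t‖ ^ 2) * ∑ i, ‖fderiv ℝ ψ x (b i)‖ ^ 2 :=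
        Finset.sum_mul_sq_le_sq_mul_sq _ _ _
    _ = ‖t‖ ^ 2 * gradSq b ψ x := by rw [b.sum_sq_norm_inner_right, gradSq]

theorem sub_comp_sub_eq_setIntegral_fderiv [CompleteSpace F] (hψ : ContDiff ℝ ∞ ψ) (x t : E) :
    ψ x - ψ (x - t) = ∫ s in Set.Ioc (0 : ℝ) 1, fderiv ℝ ψ (x - s • t) t := by
  have hderiv : ∀ s : ℝ, HasDerivAt (fun s : ℝ => -ψ (x - s • t)) (fderiv ℝ ψ (x - s • t) t) s := by
    intro s
    have hline : HasDerivAt (fun s : ℝ => x - s • t) (-t) s := by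
      simpa using ((hasDerivAt_id s).smul_const t).const_sub x
    simpa using!
      ((hψ.differentiable (by simp) (x - s • t)).hasFDerivAt.comp_hasDerivAt s hline).neg
  have hcont : Continuous fun s : ℝ => fderiv ℝ ψ (x - s • t) t :=
    (contDiff_fderiv_apply hψ t).continuous.comp (by fun_prop)
  rw [← intervalIntegral.integral_of_le zero_le_one,
    intervalIntegral.integral_eq_sub_of_hasDerivAt (fun s _ => hderiv s)
      (hcont.intervalIntegrable 0 1)]
  simp [neg_add_eq_sub]

theorem norm_sub_translate_sq_le [CompleteSpace F] (b : OrthonormalBasis ι ℝ E)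
    (hψ : ContDiff ℝ ∞ ψ) (x t : E) :
    ‖ψ x - ψ (x - t)‖ ^ 2 ≤ ∫ s in Set.Ioc (0 : ℝ) 1, ‖t‖ ^ 2 * gradSq b ψ (x - s • t) := by
  have hI : ∀ g : ℝ → ℝ, Continuous g → IntegrableOn g (Set.Ioc (0 : ℝ) 1) := fun g hg =>
    hg.integrableOn_Icc.mono_set Set.Ioc_subset_Icc_self
  have hcont : Continuous fun s : ℝ => fderiv ℝ ψ (x - s • t) t :=
    (contDiff_fderiv_apply hψ t).continuous.comp (by fun_prop)
  have hgrad : Continuous fun s : ℝ => gradSq b ψ (x - s • t) :=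
    (continuous_gradSq b hψ).comp (by fun_prop)
  calc ‖ψ x - ψ (x - t)‖ ^ 2
      ≤ (∫ s in Set.Ioc (0 : ℝ) 1, ‖fderiv ℝ ψ (x - s • t) t‖) ^ 2 := by
        rw [sub_comp_sub_eq_setIntegral_fderiv hψ]
        gcongr
        exact norm_integral_le_integral_norm _
    _ ≤ ∫ s in Set.Ioc (0 : ℝ) 1, ‖fderiv ℝ ψ (x - s • t) t‖ ^ 2 := by
        simpa using sq_integral_le (hI _ hcont.norm) (hI _ (hcont.norm.pow 2))
    _ ≤ ∫ s in Set.Ioc (0 : ℝ) 1, ‖t‖ ^ 2 * gradSq b ψ (x - s • t) :=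
        integral_mono (hI _ (hcont.norm.pow 2)) (hI _ (continuous_const.mul hgrad))
          fun s => norm_fderiv_apply_sq_le b ψ _ _

variable [FiniteDimensional ℝ E] [MeasurableSpace E] [BorelSpace E] (φ : ContDiffBump (0 : E))

theorem lintegral_sub_translate_le [CompleteSpace F] (b : OrthonormalBasis ι ℝ E)
    (hψ : ContDiff ℝ ∞ ψ) (t : E) :
    ∫⁻ x, ENNReal.ofReal (‖ψ x - ψ (x - t)‖ ^ 2)
      ≤ ENNReal.ofReal (‖t‖ ^ 2) * ∫⁻ x, ENNReal.ofReal (gradSq b ψ x) := by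
  have hG := continuous_gradSq b hψ
  have hcont : Continuous fun p : E × ℝ => ‖t‖ ^ 2 * gradSq b ψ (p.1 - p.2 • t) :=
    continuous_const.mul (hG.comp (by fun_prop))
  calc ∫⁻ x, ENNReal.ofReal (‖ψ x - ψ (x - t)‖ ^ 2)
      ≤ ∫⁻ x, ∫⁻ s in Set.Ioc (0 : ℝ) 1, ENNReal.ofReal (‖t‖ ^ 2 * gradSq b ψ (x - s • t)) := by
        refine lintegral_mono fun x => ?_
        have hline : Continuous fun s : ℝ => ‖t‖ ^ 2 * gradSq b ψ (x - s • t) :=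
          continuous_const.mul (hG.comp (by fun_prop))
        rw [← ofReal_integral_eq_lintegral_ofReal
          (hline.integrableOn_Icc.mono_set Set.Ioc_subset_Icc_self)
          (.of_forall fun s => mul_nonneg (by positivity) (gradSq_nonneg _ _ _))]
        exact ENNReal.ofReal_le_ofReal (norm_sub_translate_sq_le b hψ x t)
    _ = ∫⁻ s in Set.Ioc (0 : ℝ) 1, ∫⁻ x, ENNReal.ofReal (‖t‖ ^ 2 * gradSq b ψ (x - s • t)) :=
        lintegral_lintegral_swap hcont.measurable.ennreal_ofReal.aemeasurable
    _ = ∫⁻ _ in Set.Ioc (0 : ℝ) 1, ∫⁻ x, ENNReal.ofReal (‖t‖ ^ 2 * gradSq b ψ x) :=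
        lintegral_congr fun s =>
          lintegral_sub_right_eq_self (fun x => ENNReal.ofReal (‖t‖ ^ 2 * gradSq b ψ x)) (s • t)
    _ = ENNReal.ofReal (‖t‖ ^ 2) * ∫⁻ x, ENNReal.ofReal (gradSq b ψ x) := by
        simp_rw [ENNReal.ofReal_mul (sq_nonneg ‖t‖)]
        rw [lintegral_const_mul _ hG.measurable.ennreal_ofReal]
        simp

theorem norm_sub_mollify_sq_le [CompleteSpace F] (hψ : Continuous ψ) (x : E) :
    ‖ψ x - mollify φ ψ x‖ ^ 2 ≤ ∫ t, φ.normed volume t * ‖ψ x - ψ (x - t)‖ ^ 2 := by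
  have hI : ∀ g : E → F, Continuous g → Integrable fun t => φ.normed volume t • g t := fun g hg =>
    (φ.continuous_normed.smul hg).integrable_of_hasCompactSupport
      φ.hasCompactSupport_normed.smul_right
  have hIreal : ∀ g : E → ℝ, Continuous g → Integrable fun t => φ.normed volume t * g t :=
    fun g hg => (φ.continuous_normed.mul hg).integrable_of_hasCompactSupport
      φ.hasCompactSupport_normed.mul_right
  have haverage : ψ x - mollify φ ψ x = ∫ t, φ.normed volume t • (ψ x - ψ (x - t)) := by
    simp_rw [smul_sub]
    rw [integral_sub (hI _ continuous_const) (hI _ (by fun_prop)), integral_smul_const,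
      φ.integral_normed, one_smul]
    rfl
  calc ‖ψ x - mollify φ ψ x‖ ^ 2 ≤ (∫ t, φ.normed volume t * ‖ψ x - ψ (x - t)‖) ^ 2 := by
        rw [haverage]
        gcongr
        refine (norm_integral_le_integral_norm _).trans_eq
          (integral_congr_ae (.of_forall fun t => ?_))
        dsimp only
        rw [norm_smul, Real.norm_of_nonneg (φ.nonneg_normed _)]
    _ ≤ ∫ t, φ.normed volume t * ‖ψ x - ψ (x - t)‖ ^ 2 :=
        sq_integral_mul_le (fun t => φ.nonneg_normed _) φ.integrable_normed φ.integral_normed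
          (hIreal (fun t => ‖ψ x - ψ (x - t)‖) (by fun_prop))
          (hIreal (fun t => ‖ψ x - ψ (x - t)‖ ^ 2) (by fun_prop))

theorem lintegral_bump_mul_sub_translate_le [CompleteSpace F] (b : OrthonormalBasis ι ℝ E)
    (hψ : ContDiff ℝ ∞ ψ) (t : E) :
    ∫⁻ x, ENNReal.ofReal (φ.normed volume t * ‖ψ x - ψ (x - t)‖ ^ 2)
      ≤ ENNReal.ofReal (φ.normed volume t) *
        (ENNReal.ofReal (φ.rOut ^ 2) * ∫⁻ x, ENNReal.ofReal (gradSq b ψ x)) := by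
  have hψc := hψ.continuous
  have hcont : Continuous fun x => ‖ψ x - ψ (x - t)‖ ^ 2 := by fun_prop
  simp_rw [ENNReal.ofReal_mul (φ.nonneg_normed (μ := (volume : Measure E)) t)]
  rw [lintegral_const_mul _ hcont.measurable.ennreal_ofReal]
  by_cases ht : ‖t‖ < φ.rOut
  · gcongr
    refine (lintegral_sub_translate_le b hψ t).trans ?_
    gcongr
  · have hzero : φ.normed (volume : Measure E) t = 0 := by
      rwa [← Function.notMem_support, φ.support_normed_eq, mem_ball_zero_iff]
    simp [hzero]

theorem lintegral_sub_mollify_le [CompleteSpace F] (b : OrthonormalBasis ι ℝ E)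
    (hψ : ContDiff ℝ ∞ ψ) :
    ∫⁻ x, ENNReal.ofReal (‖ψ x - mollify φ ψ x‖ ^ 2)
      ≤ ENNReal.ofReal (φ.rOut ^ 2) * ∫⁻ x, ENNReal.ofReal (gradSq b ψ x) := by
  have hψc := hψ.continuous
  have hcont : Continuous fun p : E × E => φ.normed volume p.2 * ‖ψ p.1 - ψ (p.1 - p.2)‖ ^ 2 := by
    have := φ.continuous_normed (μ := (volume : Measure E))
    fun_prop
  calc ∫⁻ x, ENNReal.ofReal (‖ψ x - mollify φ ψ x‖ ^ 2)
      ≤ ∫⁻ x, ∫⁻ t, ENNReal.ofReal (φ.normed volume t * ‖ψ x - ψ (x - t)‖ ^ 2) := by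
        refine lintegral_mono fun x => ?_
        rw [← ofReal_integral_eq_lintegral_ofReal]
        · exact ENNReal.ofReal_le_ofReal (norm_sub_mollify_sq_le φ hψc x)
        · exact (hcont.comp (.prodMk_right x)).integrable_of_hasCompactSupport
            φ.hasCompactSupport_normed.mul_right
        · exact .of_forall fun t => mul_nonneg (φ.nonneg_normed _) (sq_nonneg _)
    _ = ∫⁻ t, ∫⁻ x, ENNReal.ofReal (φ.normed volume t * ‖ψ x - ψ (x - t)‖ ^ 2) :=
        lintegral_lintegral_swap hcont.measurable.ennreal_ofReal.aemeasurable
    _ ≤ ∫⁻ t, ENNReal.ofReal (φ.normed volume t) *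
          (ENNReal.ofReal (φ.rOut ^ 2) * ∫⁻ x, ENNReal.ofReal (gradSq b ψ x)) :=
        lintegral_mono fun t => lintegral_bump_mul_sub_translate_le φ b hψ t
    _ = ENNReal.ofReal (φ.rOut ^ 2) * ∫⁻ x, ENNReal.ofReal (gradSq b ψ x) := by
        rw [lintegral_mul_const _ φ.continuous_normed.measurable.ennreal_ofReal,
          ← ofReal_integral_eq_lintegral_ofReal φ.integrable_normed
            (.of_forall fun t => φ.nonneg_normed _), φ.integral_normed, ENNReal.ofReal_one, one_mul]

theorem hasCompactSupport_mollify (hc : HasCompactSupport ψ) : HasCompactSupport (mollify φ ψ) :=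
  φ.hasCompactSupport_normed.convolution _ hc

theorem integral_sub_mollify_le [CompleteSpace F] (b : OrthonormalBasis ι ℝ E)
    (hψ : ContDiff ℝ ∞ ψ) (hc : HasCompactSupport ψ) :
    ∫ x, ‖ψ x - mollify φ ψ x‖ ^ 2 ≤ φ.rOut ^ 2 * ∫ x, gradSq b ψ x := by
  have hI : Integrable fun x => ‖ψ x - mollify φ ψ x‖ ^ 2 :=
    integrable_norm_sq
      (hψ.continuous.sub (contDiff_mollify φ hψ.continuous.locallyIntegrable).continuous)
      (hc.sub (hasCompactSupport_mollify φ hc))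
  have hle := lintegral_sub_mollify_le φ b hψ
  rwa [← ofReal_integral_eq_lintegral_ofReal hI (.of_forall fun x => sq_nonneg _),
    ← ofReal_integral_eq_lintegral_ofReal (integrable_gradSq b hψ hc)
      (.of_forall fun x => gradSq_nonneg _ _ _),
    ← ENNReal.ofReal_mul (sq_nonneg _), ENNReal.ofReal_le_ofReal_iff (mul_nonneg (sq_nonneg _)
      (integral_nonneg fun x => gradSq_nonneg _ _ _))] at hle

theorem normed_sub_eq_zero_of_notMem_closedBall {r : ℝ} {z t : E} (hz : ‖z‖ ≤ r)
    (ht : t ∉ Metric.closedBall (0 : E) (r + φ.rOut)) :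
    φ.normed (volume : Measure E) (z - t) = 0 := by
  rw [← Function.notMem_support, φ.support_normed_eq, mem_ball_zero_iff, not_lt]
  rw [mem_closedBall_zero_iff, not_le] at ht
  have := norm_sub_norm_le t z
  rw [norm_sub_rev] at this
  linarith

theorem norm_mollify_sub_le {L : NNReal} (hL : LipschitzWith L (φ.normed (volume : Measure E)))
    (hψ : Continuous ψ) {r : ℝ} {x y : E} (hx : ‖x‖ ≤ r) (hy : ‖y‖ ≤ r) :
    ‖mollify φ ψ x - mollify φ ψ y‖
      ≤ L * ‖x - y‖ * ∫ t in Metric.closedBall (0 : E) (r + φ.rOut), ‖ψ t‖ := by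
  have hul : LocallyIntegrable ψ := hψ.locallyIntegrable
  have hS := Metric.isClosed_closedBall (x := (0 : E)) (ε := r + φ.rOut) |>.measurableSet
  have hI : IntegrableOn (fun t => L * ‖x - y‖ * ‖ψ t‖) (Metric.closedBall 0 (r + φ.rOut)) :=
    (continuous_const.mul hψ.norm).continuousOn.integrableOn_compact (isCompact_closedBall _ _)
  have hdiff : mollify φ ψ x - mollify φ ψ y
      = ∫ t, (φ.normed volume (x - t) - φ.normed volume (y - t)) • ψ t := by
    simp_rw [mollify_apply, sub_smul]
    exact (integral_sub (integrable_bump_sub_smul φ hul x) (integrable_bump_sub_smul φ hul y)).symm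
  rw [hdiff, ← integral_const_mul, ← integral_indicator hS]
  refine norm_integral_le_of_norm_le (hI.integrable_indicator hS) (.of_forall fun t => ?_)
  by_cases ht : t ∈ Metric.closedBall (0 : E) (r + φ.rOut)
  · rw [Set.indicator_of_mem ht, norm_smul]
    gcongr
    simpa only [dist_eq_norm, sub_sub_sub_cancel_right] using hL.dist_le_mul (x - t) (y - t)
  · rw [Set.indicator_of_notMem ht, normed_sub_eq_zero_of_notMem_closedBall φ hx ht,
      normed_sub_eq_zero_of_notMem_closedBall φ hy ht]
    simp

theorem norm_mollify_sub_sq_le {L : NNReal} (hL : LipschitzWith L (φ.normed (volume : Measure E)))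
    (hψ : Continuous ψ) (hc : HasCompactSupport ψ) {r : ℝ} {x y : E} (hx : ‖x‖ ≤ r)
    (hy : ‖y‖ ≤ r) :
    ‖mollify φ ψ x - mollify φ ψ y‖ ^ 2 ≤ (L * ‖x - y‖) ^ 2
      * (volume.real (Metric.closedBall (0 : E) (r + φ.rOut)) * ∫ t, ‖ψ t‖ ^ 2) := by
  calc ‖mollify φ ψ x - mollify φ ψ y‖ ^ 2
      ≤ (L * ‖x - y‖ * ∫ t in Metric.closedBall (0 : E) (r + φ.rOut), ‖ψ t‖) ^ 2 := by
        gcongr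
        exact norm_mollify_sub_le φ hL hψ hx hy
    _ = (L * ‖x - y‖) ^ 2 * (∫ t in Metric.closedBall (0 : E) (r + φ.rOut), ‖ψ t‖) ^ 2 :=
        mul_pow _ _ 2
    _ ≤ (L * ‖x - y‖) ^ 2
        * (volume.real (Metric.closedBall (0 : E) (r + φ.rOut)) * ∫ t, ‖ψ t‖ ^ 2) := by
        gcongr ?_ * ?_
        exact sq_setIntegral_norm_le hψ hc (isCompact_closedBall _ _).measure_lt_top.ne

theorem exists_mollify_functional (x : E) :
    ∃ T : L2 E →L[ℂ] ℂ, ∀ (f : L2 E) (ψ : E → ℂ), f =ᵐ[volume] ψ → T f = mollify φ ψ x := by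
  have hbump : MemLp (fun s => (φ.normed volume (x - s) : ℂ)) 2 (volume : Measure E) :=
    (contDiff_comp_const_sub φ.contDiff_normed x).continuous.memLp_of_hasCompactSupport
      (hasCompactSupport_comp_const_sub φ.hasCompactSupport_normed x)
  refine ⟨innerSL ℂ hbump.toLp, fun f ψ hf => ?_⟩
  rw [innerSL_apply_apply, L2.inner_def, mollify_apply]
  refine integral_congr_ae ?_
  filter_upwards [hf, hbump.coeFn_toLp] with t hft hbumpt
  rw [hft, hbumpt, RCLike.inner_apply, Complex.conj_ofReal, Complex.real_smul, mul_comm]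

theorem norm_sq_eq_integral {f : L2 E} {ψ : E → ℂ} (hf : f =ᵐ[volume] ψ) :
    ‖f‖ ^ 2 = ∫ x, ‖ψ x‖ ^ 2 := by
  rw [← inner_self_eq_norm_sq (𝕜 := ℂ) f, L2.inner_def]
  refine (integral_re (L2.integrable_inner (𝕜 := ℂ) f f)).symm.trans (integral_congr_ae ?_)
  filter_upwards [hf] with t ht
  rw [ht]
  exact inner_self_eq_norm_sq (𝕜 := ℂ) (ψ t)

end MollificationEstimates

section CompactEmbedding

theorem norm_sq_le_two_mul_add {F : Type*} [SeminormedAddCommGroup F] (a b : F) :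
    ‖a‖ ^ 2 ≤ 2 * (‖a - b‖ ^ 2 + ‖b‖ ^ 2) :=
  calc ‖a‖ ^ 2 ≤ (‖a - b‖ + ‖b‖) ^ 2 := by
        gcongr
        exact norm_le_norm_sub_add a b
    _ ≤ 2 * (‖a - b‖ ^ 2 + ‖b‖ ^ 2) := add_sq_le

theorem norm_sqrt_smul_apply_sq {G G' : Type*} [SeminormedAddCommGroup G]
    [SeminormedAddCommGroup G'] [NormedSpace ℂ G] [NormedSpace ℂ G'] (T : G →L[ℂ] G') {c : ℝ}
    (hc : 0 ≤ c) (f : G) : ‖((√c : ℂ) • T) f‖ ^ 2 = c * ‖T f‖ ^ 2 := by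
  rw [smul_apply, norm_smul, Complex.norm_real, Real.norm_of_nonneg (Real.sqrt_nonneg c), mul_pow,
    Real.sq_sqrt hc]

theorem exists_closedBall_forall_notMem_le {E : Type*} [SeminormedAddCommGroup E] {W : E → ℝ}
    (hW : Tendsto W (cocompact E) atTop) (c : ℝ) :
    ∃ r, ∀ x ∉ Metric.closedBall (0 : E) r, c ≤ W x := by
  obtain ⟨K, hK, hKW⟩ := mem_cocompact.1 (hW.eventually_ge_atTop c)
  obtain ⟨r, hKr⟩ := hK.isBounded.subset_closedBall 0
  exact ⟨r, fun x hx => hKW fun hxK => hx (hKr hxK)⟩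

variable {E : Type*} [NormedAddCommGroup E] [InnerProductSpace ℝ E] [FiniteDimensional ℝ E]
  [MeasurableSpace E] [BorelSpace E] {ι : Type*} [Fintype ι]

-- By equicontinuity, the mollification on a ball is controlled by its values on a finite net.
theorem exists_functional_norm_mollify_sq_le (φ : ContDiffBump (0 : E)) (r : ℝ) {ε : ℝ}
    (hε : 0 < ε) :
    ∃ (N : ℕ) (T : L2 E →L[ℂ] (Fin N → ℂ)), ∀ (f : L2 E) (ψ : E → ℂ), Continuous ψ →
      HasCompactSupport ψ → f =ᵐ[volume] ψ → ∀ x ∈ Metric.closedBall (0 : E) r,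
      ‖mollify φ ψ x‖ ^ 2 ≤ ε * (∫ t, ‖ψ t‖ ^ 2) + ‖T f‖ ^ 2 := by
  obtain ⟨L, hL⟩ := (φ.contDiff_normed (n := 1)
    (μ := (volume : Measure E))).lipschitzWith_of_hasCompactSupport
      φ.hasCompactSupport_normed one_ne_zero
  set v := volume.real (Metric.closedBall (0 : E) (r + φ.rOut))
  obtain ⟨η, hηε, hη⟩ : ∃ η : ℝ, 2 * ((L * η) ^ 2 * v) ≤ ε ∧ 0 < η := by
    have hlim : Tendsto (fun η : ℝ => 2 * ((L * η) ^ 2 * v)) (𝓝[>] 0)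
        (𝓝 (2 * ((L * 0) ^ 2 * v))) :=
      (Continuous.tendsto (by fun_prop) 0).mono_left nhdsWithin_le_nhds
    exact ((hlim.eventually_le_const (by simpa using hε)).and eventually_mem_nhdsWithin).exists
  obtain ⟨s, hsub, hfin, hcover⟩ := Metric.finite_approx_of_totallyBounded
    (isCompact_closedBall (0 : E) r).totallyBounded η hη
  obtain ⟨N, y, -, hy⟩ := hfin.fin_param
  choose T hT using exists_mollify_functional φ
  refine ⟨N, (√2 : ℂ) • .pi fun i => T (y i), fun f ψ hψ hc hf x hx => ?_⟩
  rw [norm_sqrt_smul_apply_sq _ zero_le_two]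
  obtain ⟨i, hxi⟩ : ∃ i, x ∈ Metric.ball (y i) η := by
    simpa [← hy] using hcover hx
  have hyi : y i ∈ Metric.closedBall (0 : E) r := hsub (hy ▸ Set.mem_range_self i)
  rw [mem_closedBall_zero_iff] at hx hyi
  rw [mem_ball_iff_norm] at hxi
  have hdiff : ‖mollify φ ψ x - mollify φ ψ (y i)‖ ^ 2 ≤ (L * η) ^ 2 * (v * ∫ t, ‖ψ t‖ ^ 2) := by
    refine (norm_mollify_sub_sq_le φ hL hψ hc hx hyi).trans ?_
    gcongr
  have hnet : ‖mollify φ ψ (y i)‖ ≤ ‖ContinuousLinearMap.pi (fun i => T (y i)) f‖ := by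
    rw [← hT (y i) f ψ hf]
    exact norm_le_pi_norm (ContinuousLinearMap.pi (fun i => T (y i)) f) i
  calc ‖mollify φ ψ x‖ ^ 2
      ≤ 2 * (‖mollify φ ψ x - mollify φ ψ (y i)‖ ^ 2 + ‖mollify φ ψ (y i)‖ ^ 2) :=
        norm_sq_le_two_mul_add _ _
    _ ≤ 2 * ((L * η) ^ 2 * (v * ∫ t, ‖ψ t‖ ^ 2)
          + ‖ContinuousLinearMap.pi (fun i => T (y i)) f‖ ^ 2) := by gcongr
    _ = 2 * ((L * η) ^ 2 * v) * (∫ t, ‖ψ t‖ ^ 2)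
          + 2 * ‖ContinuousLinearMap.pi (fun i => T (y i)) f‖ ^ 2 := by ring
    _ ≤ ε * (∫ t, ‖ψ t‖ ^ 2) + 2 * ‖ContinuousLinearMap.pi (fun i => T (y i)) f‖ ^ 2 := by
        gcongr ?_ + _
        exact mul_le_mul_of_nonneg_right hηε (integral_nonneg fun t => sq_nonneg _)

theorem exists_functional_setIntegral_mollify_sq_le (φ : ContDiffBump (0 : E)) (r : ℝ) {ε : ℝ}
    (hε : 0 < ε) :
    ∃ (N : ℕ) (T : L2 E →L[ℂ] (Fin N → ℂ)), ∀ (f : L2 E) (ψ : E → ℂ), Continuous ψ →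
      HasCompactSupport ψ → f =ᵐ[volume] ψ →
      ∫ x in Metric.closedBall (0 : E) r, ‖mollify φ ψ x‖ ^ 2
        ≤ ε * (∫ t, ‖ψ t‖ ^ 2) + ‖T f‖ ^ 2 := by
  set v := volume.real (Metric.closedBall (0 : E) r)
  have hv : 0 ≤ v := measureReal_nonneg
  obtain ⟨N, T, hT⟩ := exists_functional_norm_mollify_sq_le φ r
    (by positivity : 0 < ε / (v + 1))
  refine ⟨N, (√v : ℂ) • T, fun f ψ hψ hc hf => ?_⟩
  rw [norm_sqrt_smul_apply_sq _ hv]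
  have hm : Continuous fun x => ‖mollify φ ψ x‖ ^ 2 :=
    (contDiff_mollify φ hψ.locallyIntegrable).continuous.norm.pow 2
  have : 0 ≤ ∫ t, ‖ψ t‖ ^ 2 := integral_nonneg fun t => sq_nonneg _
  calc ∫ x in Metric.closedBall (0 : E) r, ‖mollify φ ψ x‖ ^ 2
      ≤ ∫ _ in Metric.closedBall (0 : E) r, (ε / (v + 1) * (∫ t, ‖ψ t‖ ^ 2) + ‖T f‖ ^ 2) :=
        setIntegral_mono_on (hm.continuousOn.integrableOn_compact (isCompact_closedBall _ _))
          (integrableOn_const (isCompact_closedBall _ _).measure_lt_top.ne)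
          Metric.isClosed_closedBall.measurableSet (hT f ψ hψ hc hf)
    _ = ε * (v / (v + 1)) * (∫ t, ‖ψ t‖ ^ 2) + v * ‖T f‖ ^ 2 := by
        rw [setIntegral_const, smul_eq_mul]
        ring
    _ ≤ ε * 1 * (∫ t, ‖ψ t‖ ^ 2) + v * ‖T f‖ ^ 2 := by
        gcongr ε * ?_ * _ + _
        exact div_le_one_of_le₀ (by linarith) (by positivity)
    _ = ε * (∫ t, ‖ψ t‖ ^ 2) + v * ‖T f‖ ^ 2 := by rw [mul_one]

theorem setIntegral_norm_sq_le_of_mollify (b : OrthonormalBasis ι ℝ E) (φ : ContDiffBump (0 : E))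
    {ψ : E → ℂ} (hψ : ContDiff ℝ ∞ ψ) (hc : HasCompactSupport ψ) (S : Set E) :
    ∫ x in S, ‖ψ x‖ ^ 2
      ≤ 2 * (φ.rOut ^ 2 * (∫ x, gradSq b ψ x) + ∫ x in S, ‖mollify φ ψ x‖ ^ 2) := by
  have hm := (contDiff_mollify φ hψ.continuous.locallyIntegrable).continuous
  have hmc := hasCompactSupport_mollify φ hc
  have hIdiff : Integrable fun x => ‖ψ x - mollify φ ψ x‖ ^ 2 :=
    integrable_norm_sq (hψ.continuous.sub hm) (hc.sub hmc)
  have hIm := integrable_norm_sq hm hmc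
  calc ∫ x in S, ‖ψ x‖ ^ 2
      ≤ ∫ x in S, 2 * (‖ψ x - mollify φ ψ x‖ ^ 2 + ‖mollify φ ψ x‖ ^ 2) :=
        integral_mono (integrable_norm_sq hψ.continuous hc).integrableOn
          ((hIdiff.fun_add hIm).const_mul 2).integrableOn fun x => norm_sq_le_two_mul_add _ _
    _ = 2 * ((∫ x in S, ‖ψ x - mollify φ ψ x‖ ^ 2) + ∫ x in S, ‖mollify φ ψ x‖ ^ 2) := by
        rw [integral_const_mul, integral_add hIdiff.integrableOn hIm.integrableOn]
    _ ≤ 2 * (φ.rOut ^ 2 * (∫ x, gradSq b ψ x) + ∫ x in S, ‖mollify φ ψ x‖ ^ 2) := by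
        gcongr 2 * (?_ + _)
        exact (setIntegral_le_integral hIdiff (.of_forall fun x => sq_nonneg _)).trans
          (integral_sub_mollify_le φ b hψ hc)

theorem mul_setIntegral_norm_sq_le {W : E → ℝ} (hW : Continuous W) (hW0 : ∀ x, 0 ≤ W x) {S : Set E}
    (hS : MeasurableSet S) {c : ℝ} (hc : ∀ x ∈ S, c ≤ W x) {ψ : E → ℂ} (hψ : Continuous ψ)
    (hψc : HasCompactSupport ψ) : c * ∫ x in S, ‖ψ x‖ ^ 2 ≤ ∫ x, W x * ‖ψ x‖ ^ 2 := by
  have hIW := integrable_mul_norm_sq hW hψ hψc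
  rw [← integral_const_mul]
  calc ∫ x in S, c * ‖ψ x‖ ^ 2 ≤ ∫ x in S, W x * ‖ψ x‖ ^ 2 :=
        setIntegral_mono_on ((integrable_norm_sq hψ hψc).const_mul c).integrableOn
          hIW.integrableOn hS fun x hx => mul_le_mul_of_nonneg_right (hc x hx) (sq_nonneg _)
    _ ≤ ∫ x, W x * ‖ψ x‖ ^ 2 :=
        setIntegral_le_integral hIW (.of_forall fun x => mul_nonneg (hW0 x) (sq_nonneg _))

-- Outside a large ball `‖ψ‖²` is controlled by the weight; inside it, `ψ` is close to its
-- mollification, which is controlled by finitely many functionals.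
theorem exists_functional_norm_sq_le (b : OrthonormalBasis ι ℝ E) {W : E → ℝ} (hW : Continuous W)
    (hW1 : ∀ x, 1 ≤ W x) (hWlim : Tendsto W (cocompact E) atTop) {κ : ℝ} (hκ : 0 < κ) {ε : ℝ}
    (hε : 0 < ε) :
    ∃ (N : ℕ) (T : L2 E →L[ℂ] (Fin N → ℂ)), ∀ (f : L2 E) (ψ : E → ℂ), ContDiff ℝ ∞ ψ →
      HasCompactSupport ψ → f =ᵐ[volume] ψ →
      ‖f‖ ^ 2 ≤ ε * (∫ x, (κ * gradSq b ψ x + W x * ‖ψ x‖ ^ 2)) + ‖T f‖ ^ 2 := by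
  obtain ⟨r, hr⟩ := exists_closedBall_forall_notMem_le hWlim (2 / ε)
  have hh : 0 < √(ε * κ / 2) := by positivity
  let φ : ContDiffBump (0 : E) := ⟨√(ε * κ / 2) / 2, √(ε * κ / 2), half_pos hh, half_lt_self hh⟩
  have hφ : φ.rOut ^ 2 = ε * κ / 2 := Real.sq_sqrt (by positivity)
  obtain ⟨N, T, hT⟩ := exists_functional_setIntegral_mollify_sq_le φ r (by positivity : 0 < ε / 4)
  refine ⟨N, (√2 : ℂ) • T, fun f ψ hψ hc hf => ?_⟩
  rw [norm_sqrt_smul_apply_sq _ zero_le_two, norm_sq_eq_integral hf]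
  have hB : MeasurableSet (Metric.closedBall (0 : E) r) := Metric.isClosed_closedBall.measurableSet
  have hI := integrable_norm_sq hψ.continuous hc
  have hIW := integrable_mul_norm_sq hW hψ.continuous hc
  have hinside := setIntegral_norm_sq_le_of_mollify b φ hψ hc (Metric.closedBall 0 r)
  have hmollify := hT f ψ hψ.continuous hc hf
  have houtside : ∫ x in (Metric.closedBall (0 : E) r)ᶜ, ‖ψ x‖ ^ 2
      ≤ ε / 2 * ∫ x, W x * ‖ψ x‖ ^ 2 := by
    have := mul_setIntegral_norm_sq_le hW (fun x => zero_le_one.trans (hW1 x)) hB.compl hr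
      hψ.continuous hc
    rwa [div_mul_eq_mul_div, div_le_iff₀ hε, ← le_div_iff₀' zero_lt_two, mul_comm _ ε,
      mul_div_right_comm] at this
  have hweight : ∫ x, ‖ψ x‖ ^ 2 ≤ ∫ x, W x * ‖ψ x‖ ^ 2 :=
    integral_mono hI hIW fun x => le_mul_of_one_le_left (sq_nonneg _) (hW1 x)
  have hform : ∫ x, (κ * gradSq b ψ x + W x * ‖ψ x‖ ^ 2)
      = κ * (∫ x, gradSq b ψ x) + ∫ x, W x * ‖ψ x‖ ^ 2 := by
    rw [integral_add ((integrable_gradSq b hψ hc).const_mul κ) hIW, integral_const_mul]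
  rw [hφ] at hinside
  rw [hform, ← integral_add_compl hB hI]
  nlinarith [mul_le_mul_of_nonneg_left hweight hε.le]

end CompactEmbedding

section ResolventOfSchrodinger

variable {E : Type*} [NormedAddCommGroup E] [InnerProductSpace ℝ E] [FiniteDimensional ℝ E]
  [MeasurableSpace E] [BorelSpace E] {V : E → ℝ} {ψ : E → ℂ}

theorem exists_coreOperator_domain_ae_eq (hV : Continuous V) (hψ : ContDiff ℝ ∞ ψ)
    (hc : HasCompactSupport ψ) :
    ∃ f : (coreOperator V).domain, ((f : L2 E) =ᵐ[volume] ψ) ∧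
      (coreOperator V f =ᵐ[volume] expr V ψ) := by
  have hψL2 : MemLp ψ 2 (volume : Measure E) := hψ.continuous.memLp_of_hasCompactSupport hc
  have hexprL2 : MemLp (expr V ψ) 2 (volume : Measure E) :=
    (continuous_expr hV hψ).memLp_of_hasCompactSupport (hasCompactSupport_expr hψ hc)
  have hmem : (hψL2.toLp, hexprL2.toLp) ∈ (coreOperator V).graph := by
    rw [coreOperator_graph]
    exact ⟨ψ, hψ, hc, hψL2.coeFn_toLp, hexprL2.coeFn_toLp⟩
  obtain ⟨f, hf, hAf⟩ := (LinearPMap.mem_graph_iff _).1 hmem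
  dsimp only at hf hAf
  exact ⟨f, hf ▸ hψL2.coeFn_toLp, hAf ▸ hexprL2.coeFn_toLp⟩

theorem exists_contDiff_ae_eq (f : (coreOperator V).domain) :
    ∃ ψ : E → ℂ, ContDiff ℝ ∞ ψ ∧ HasCompactSupport ψ ∧ ((f : L2 E) =ᵐ[volume] ψ) ∧
      (coreOperator V f =ᵐ[volume] expr V ψ) := by
  have hmem := (coreOperator V).mem_graph f
  rwa [coreOperator_graph] at hmem

theorem inner_eq_integral {f g : L2 E} {ψ χ : E → ℂ} (hf : f =ᵐ[volume] ψ)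
    (hg : g =ᵐ[volume] χ) : inner ℂ f g = ∫ x, conj (ψ x) * χ x := by
  rw [L2.inner_def]
  refine integral_congr_ae ?_
  filter_upwards [hf, hg] with x hfx hgx
  rw [hfx, hgx, RCLike.inner_apply, mul_comm]

theorem dense_coreOperator_domain (hV : Continuous V) :
    Dense ((coreOperator V).domain : Set (L2 E)) := by
  rw [Submodule.dense_iff_topologicalClosure_eq_top, Submodule.topologicalClosure_eq_top_iff,
    Submodule.eq_bot_iff]
  intro u hu
  rw [Lp.eq_zero_iff_ae_eq_zero]
  refine ae_eq_zero_of_integral_contDiff_smul_eq_zero ((Lp.memLp u).locallyIntegrable one_le_two)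
    fun g hg hgc => ?_
  obtain ⟨f, hf, -⟩ := exists_coreOperator_domain_ae_eq hV (ψ := fun x => (g x : ℂ))
    (Complex.ofRealCLM.contDiff.comp hg)
    (hgc.comp_left (g := fun r : ℝ => (r : ℂ)) Complex.ofReal_zero)
  have horth := (Submodule.mem_orthogonal _ _).1 hu f f.2
  rw [inner_eq_integral hf .rfl] at horth
  simpa only [Complex.conj_ofReal, Complex.real_smul] using horth

theorem coreOperator_isFormalAdjoint (hV : Continuous V) :
    (coreOperator V).IsFormalAdjoint (coreOperator V) := by
  intro f g
  obtain ⟨ψ, hψ, hc, hf, hAf⟩ := exists_contDiff_ae_eq f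
  obtain ⟨χ, hχ, hcχ, hg, hAg⟩ := exists_contDiff_ae_eq g
  rw [inner_eq_integral hAf hg, inner_eq_integral hf hAg, integral_conj_expr_mul hV hψ hc hχ hcχ]

theorem shift_coreOperator_ae_eq (μ : ℝ) {f : (coreOperator V).domain}
    (hf : (f : L2 E) =ᵐ[volume] ψ) (hAf : coreOperator V f =ᵐ[volume] expr V ψ) :
    shift (coreOperator V) μ f =ᵐ[volume] expr (fun x => V x + μ) ψ := by
  rw [shift_apply]
  filter_upwards [Lp.coeFn_add (coreOperator V f) ((μ : ℂ) • (f : L2 E)),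
    Lp.coeFn_smul (μ : ℂ) (f : L2 E), hf, hAf] with x hadd hsmul hfx hAfx
  rw [hadd, Pi.add_apply, hsmul, Pi.smul_apply, hfx, hAfx, expr, expr, smul_eq_mul]
  push_cast
  ring

variable {ι : Type*} [Fintype ι] {b : OrthonormalBasis ι ℝ E} {μ : ℝ}

theorem re_inner_shift_coreOperator (b : OrthonormalBasis ι ℝ E) (hV : Continuous V)
    {f : (coreOperator V).domain} (hψ : ContDiff ℝ ∞ ψ) (hc : HasCompactSupport ψ)
    (hf : (f : L2 E) =ᵐ[volume] ψ) (hAf : coreOperator V f =ᵐ[volume] expr V ψ) :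
    (inner ℂ (f : L2 E) (shift (coreOperator V) μ f)).re = energy b (fun x => V x + μ) ψ := by
  rw [inner_eq_integral hf (shift_coreOperator_ae_eq μ hf hAf),
    re_integral_conj_mul_expr_self b (by fun_prop) hψ hc]

theorem isBoundedBelowBy_coreOperator (hV : Continuous V)
    (hone : ∀ ψ : E → ℂ, ContDiff ℝ ∞ ψ → HasCompactSupport ψ →
      ∫ x, ‖ψ x‖ ^ 2 ≤ energy b (fun x => V x + μ) ψ) :
    IsBoundedBelowBy (coreOperator V) (1 - μ) := by
  intro f
  obtain ⟨ψ, hψ, hc, hf, hAf⟩ := exists_contDiff_ae_eq f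
  have hle := hone ψ hψ hc
  rw [← re_inner_shift_coreOperator b hV hψ hc hf hAf, ← norm_sq_eq_integral hf,
    re_inner_shift] at hle
  linarith

theorem denseRange_shift_coreOperator (hV : Continuous V)
    (hone : ∀ ψ : E → ℂ, ContDiff ℝ ∞ ψ → HasCompactSupport ψ →
      ∫ x, ‖ψ x‖ ^ 2 ≤ energy b (fun x => V x + μ) ψ) :
    DenseRange (shift (coreOperator V) μ) := by
  refine denseRange_shift fun u hu => ?_
  have hweak : IsWeakSolution (fun x => V x + μ) u := by
    intro ψ hψ hc
    obtain ⟨f, hf, hAf⟩ := exists_coreOperator_domain_ae_eq hV hψ hc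
    rw [← inner_eq_integral .rfl (shift_coreOperator_ae_eq μ hf hAf)]
    exact hu f
  rw [Lp.eq_zero_iff_ae_eq_zero]
  exact hweak.ae_eq_zero (by fun_prop) hone (Lp.memLp u)

theorem energy_add_const (b : OrthonormalBasis ι ℝ E) (hV : Continuous V) (μ : ℝ)
    (hψ : ContDiff ℝ ∞ ψ) (hc : HasCompactSupport ψ) :
    energy b (fun x => V x + μ) ψ = energy b V ψ + μ * ∫ x, ‖ψ x‖ ^ 2 := by
  rw [energy_eq b (by fun_prop) hψ hc, energy_eq b hV hψ hc, add_assoc, ← integral_const_mul,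
    ← integral_add (integrable_mul_norm_sq hV hψ.continuous hc)
      ((integrable_norm_sq hψ.continuous hc).const_mul μ)]
  simp_rw [add_mul]

variable {W : E → ℝ} {κ : ℝ}

theorem exists_isCompactResolvent_schrodinger_of_one_le (hV : Continuous V) (hW : Continuous W)
    (hW1 : ∀ x, 1 ≤ W x) (hWlim : Tendsto W (cocompact E) atTop) (hκ : 0 < κ)
    (hVW : ∀ ψ : E → ℂ, ContDiff ℝ ∞ ψ → HasCompactSupport ψ →
      ∫ x, (κ * gradSq b ψ x + W x * ‖ψ x‖ ^ 2) ≤ energy b (fun x => V x + μ) ψ) :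
    ∃ R, IsCompactResolvent (schrodinger V) μ R := by
  have hone : ∀ ψ : E → ℂ, ContDiff ℝ ∞ ψ → HasCompactSupport ψ →
      ∫ x, ‖ψ x‖ ^ 2 ≤ energy b (fun x => V x + μ) ψ := fun ψ hψ hc => by
    refine le_trans (integral_mono (integrable_norm_sq hψ.continuous hc)
      (((integrable_gradSq b hψ hc).const_mul κ).fun_add
        (integrable_mul_norm_sq hW hψ.continuous hc)) fun x => ?_) (hVW ψ hψ hc)
    exact (le_mul_of_one_le_left (sq_nonneg ‖ψ x‖) (hW1 x)).trans
      (le_add_of_nonneg_left (mul_nonneg hκ.le (gradSq_nonneg b ψ x)))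
  refine exists_isCompactResolvent_closure (dense_coreOperator_domain hV)
    (coreOperator_isFormalAdjoint hV) (isBoundedBelowBy_coreOperator hV hone)
    (denseRange_shift_coreOperator hV hone) fun ε hε => ?_
  obtain ⟨N, T, hT⟩ := exists_functional_norm_sq_le b hW hW1 hWlim hκ hε
  refine ⟨N, T, fun f => ?_⟩
  obtain ⟨ψ, hψ, hc, hf, hAf⟩ := exists_contDiff_ae_eq f
  rw [re_inner_shift_coreOperator b hV hψ hc hf hAf]
  refine (hT f ψ hψ hc hf).trans ?_
  gcongr
  exact hVW ψ hψ hc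

theorem exists_isCompactResolvent_schrodinger (hV : Continuous V) (hW : Continuous W)
    (hWlim : Tendsto W (cocompact E) atTop) (hκ : 0 < κ)
    (hVW : ∀ ψ : E → ℂ, ContDiff ℝ ∞ ψ → HasCompactSupport ψ →
      ∫ x, (κ * gradSq b ψ x + W x * ‖ψ x‖ ^ 2) ≤ energy b V ψ) :
    ∃ μ R, IsCompactResolvent (schrodinger V) μ R := by
  obtain ⟨x₀, hx₀⟩ := hW.exists_forall_le hWlim
  refine ⟨1 - W x₀, exists_isCompactResolvent_schrodinger_of_one_le (b := b) hV
    (W := fun x => W x + (1 - W x₀)) (by fun_prop) (fun x => by linarith [hx₀ x])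
    (tendsto_atTop_add_const_right _ _ hWlim) hκ fun ψ hψ hc => ?_⟩
  have hI : Integrable fun x => κ * gradSq b ψ x + W x * ‖ψ x‖ ^ 2 :=
    ((integrable_gradSq b hψ hc).const_mul κ).add (integrable_mul_norm_sq hW hψ.continuous hc)
  calc ∫ x, (κ * gradSq b ψ x + (W x + (1 - W x₀)) * ‖ψ x‖ ^ 2)
      = (∫ x, (κ * gradSq b ψ x + W x * ‖ψ x‖ ^ 2)) + (1 - W x₀) * ∫ x, ‖ψ x‖ ^ 2 := by
        rw [← integral_const_mul,
          ← integral_add hI ((integrable_norm_sq hψ.continuous hc).const_mul _)]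
        simp_rw [add_mul, add_assoc]
    _ ≤ energy b V ψ + (1 - W x₀) * ∫ x, ‖ψ x‖ ^ 2 := by
        gcongr ?_ + _
        exact hVW ψ hψ hc
    _ = energy b (fun x => V x + (1 - W x₀)) ψ := (energy_add_const b hV _ hψ hc).symm

theorem mul_integral_norm_sq_le_energy (b : OrthonormalBasis ι ℝ E) (hV : Continuous V) {c : ℝ}
    (h : IsBoundedBelowBy (schrodinger V) c) (hψ : ContDiff ℝ ∞ ψ)
    (hc : HasCompactSupport ψ) : c * ∫ x, ‖ψ x‖ ^ 2 ≤ energy b V ψ := by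
  obtain ⟨f, hf, hAf⟩ := exists_coreOperator_domain_ae_eq hV hψ hc
  have hext := (coreOperator V).le_closure
  have hle := h ⟨f, hext.1 f.2⟩
  rwa [show schrodinger V ⟨f, hext.1 f.2⟩ = coreOperator V f from (hext.2 rfl).symm,
    norm_sq_eq_integral hf, inner_eq_integral hf hAf,
    re_integral_conj_mul_expr_self b hV hψ hc] at hle

end ResolventOfSchrodinger

section Oscillator

variable {p : ℝ}

theorem continuous_abs_rpow (hp : 0 ≤ p) : Continuous fun t : ℝ => |t| ^ p :=
  continuous_abs.rpow_const fun _ => Or.inr hp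

theorem tendsto_abs_rpow_cocompact (hp : 0 < p) :
    Tendsto (fun t : ℝ => |t| ^ p) (cocompact ℝ) atTop :=
  (tendsto_rpow_atTop hp).comp tendsto_norm_cocompact_atTop

theorem energy_singleton (V : ℝ → ℝ) (ψ : ℝ → ℂ) :
    energy (OrthonormalBasis.singleton (Fin 1) ℝ) V ψ
      = ∫ t, (‖deriv ψ t‖ ^ 2 + V t * ‖ψ t‖ ^ 2) := by
  simp [energy, gradSq]

theorem exists_isCompactResolvent_oscillator (hp : 0 < p) :
    ∃ R, IsCompactResolvent (oscillator p) 1 R := by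
  have hV := continuous_abs_rpow hp.le
  have hW : Continuous fun t : ℝ => |t| ^ p + 1 := hV.add continuous_const
  refine exists_isCompactResolvent_schrodinger_of_one_le
    (b := OrthonormalBasis.singleton (Fin 1) ℝ) hV hW (fun t => ?_)
    (tendsto_atTop_add_const_right _ _ (tendsto_abs_rpow_cocompact hp)) one_pos fun ψ _ _ => ?_
  · exact le_add_of_nonneg_left (by positivity)
  · simp only [one_mul]
    exact le_rfl

instance nontrivial_L2_real : Nontrivial (L2 ℝ) := by
  refine ⟨⟨indicatorConstLp 2 (measurableSet_Icc (a := (0 : ℝ)) (b := 1)) (by simp) (1 : ℂ), 0,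
    fun h => ?_⟩⟩
  have hnorm := congrArg norm h
  rw [norm_indicatorConstLp (by norm_num) (by norm_num)] at hnorm
  simp [Measure.real] at hnorm

theorem IsCompactResolvent.groundEnergy_eq {μ : ℝ} {R : L2 ℝ →L[ℂ] L2 ℝ}
    (h : IsCompactResolvent (oscillator p) μ R) : groundEnergy p = ‖R‖⁻¹ - μ :=
  h.isLeast_isEigenvalue.csInf_eq

theorem isLeast_groundEnergy (hp : 0 < p) :
    IsLeast {μ : ℝ | IsEigenvalue (oscillator p) (μ : ℂ)} (groundEnergy p) := by
  obtain ⟨R, hR⟩ := exists_isCompactResolvent_oscillator hp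
  exact hR.groundEnergy_eq ▸ hR.isLeast_isEigenvalue

theorem groundEnergy_nonneg (hp : 0 < p) : 0 ≤ groundEnergy p := by
  obtain ⟨R, hR⟩ := exists_isCompactResolvent_oscillator hp
  simpa using hR.isBoundedBelowBy.le_re_of_isEigenvalue (isLeast_groundEnergy hp).1

theorem isBoundedBelowBy_oscillator (hp : 0 < p) :
    IsBoundedBelowBy (oscillator p) (groundEnergy p) := by
  obtain ⟨R, hR⟩ := exists_isCompactResolvent_oscillator hp
  exact hR.groundEnergy_eq ▸ hR.isBoundedBelowBy_inv_norm_sub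

variable {g : ℝ → ℂ}

theorem groundEnergy_mul_integral_le (hp : 0 < p) (hg : ContDiff ℝ ∞ g)
    (hc : HasCompactSupport g) :
    groundEnergy p * ∫ t, ‖g t‖ ^ 2 ≤ ∫ t, (‖deriv g t‖ ^ 2 + |t| ^ p * ‖g t‖ ^ 2) := by
  rw [← energy_singleton]
  exact mul_integral_norm_sq_le_energy _ (continuous_abs_rpow hp.le)
    (isBoundedBelowBy_oscillator hp) hg hc

theorem groundEnergy_mul_sq_mul_integral_le (hp : 0 < p) (hg : ContDiff ℝ ∞ g)
    (hc : HasCompactSupport g) {κ : ℝ} (hκ : 0 < κ) :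
    groundEnergy p * κ ^ 2 * ∫ t, ‖g t‖ ^ 2
      ≤ ∫ t, (‖deriv g t‖ ^ 2 + κ ^ 2 * |κ * t| ^ p * ‖g t‖ ^ 2) := by
  have hscaled : ContDiff ℝ ∞ fun u => g (κ⁻¹ * u) := hg.comp (contDiff_const.mul contDiff_id)
  have hscaledc : HasCompactSupport fun u => g (κ⁻¹ * u) := by
    simpa only [smul_eq_mul] using! hc.comp_smul (inv_ne_zero hκ.ne')
  have hintegrand : ∀ u, ‖deriv (fun u => g (κ⁻¹ * u)) u‖ ^ 2 + |u| ^ p * ‖g (κ⁻¹ * u)‖ ^ 2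
      = (fun t => κ⁻¹ ^ 2 * ‖deriv g t‖ ^ 2 + |κ * t| ^ p * ‖g t‖ ^ 2) (κ⁻¹ * u) := fun u => by
    dsimp only
    rw [deriv_comp_mul_left κ⁻¹ g u, norm_smul, Real.norm_eq_abs, mul_pow, sq_abs,
      mul_inv_cancel_left₀ hκ.ne']
  have hle := groundEnergy_mul_integral_le hp hscaled hscaledc
  simp_rw [hintegrand] at hle
  rw [Measure.integral_comp_mul_left fun t => ‖g t‖ ^ 2,
    Measure.integral_comp_mul_left fun t => κ⁻¹ ^ 2 * ‖deriv g t‖ ^ 2 + |κ * t| ^ p * ‖g t‖ ^ 2,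
    inv_inv, abs_of_pos hκ, smul_eq_mul, smul_eq_mul, mul_left_comm] at hle
  calc groundEnergy p * κ ^ 2 * ∫ t, ‖g t‖ ^ 2
      = κ ^ 2 * (groundEnergy p * ∫ t, ‖g t‖ ^ 2) := by ring
    _ ≤ κ ^ 2 * ∫ t, (κ⁻¹ ^ 2 * ‖deriv g t‖ ^ 2 + |κ * t| ^ p * ‖g t‖ ^ 2) :=
        mul_le_mul_of_nonneg_left (le_of_mul_le_mul_left hle hκ) (sq_nonneg κ)
    _ = ∫ t, (‖deriv g t‖ ^ 2 + κ ^ 2 * |κ * t| ^ p * ‖g t‖ ^ 2) := by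
        rw [← integral_const_mul]
        congr with t
        field_simp

theorem groundEnergy_mul_rpow_mul_integral_le (hp : 0 < p) (hg : ContDiff ℝ ∞ g)
    (hc : HasCompactSupport g) (s : ℝ) :
    groundEnergy p * (s ^ 2) ^ (p / (p + 2)) * ∫ t, ‖g t‖ ^ 2
      ≤ ∫ t, (‖deriv g t‖ ^ 2 + |s * t| ^ p * ‖g t‖ ^ 2) := by
  rcases eq_or_ne s 0 with rfl | hs
  · rw [zero_pow two_ne_zero, Real.zero_rpow (by positivity), mul_zero, zero_mul]
    exact integral_nonneg fun t => by positivity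
  have hs0 : 0 < |s| := abs_pos.2 hs
  -- The scaling `t ↦ κ t` with `κ ^ (p + 2) = |s| ^ p`.
  set κ : ℝ := |s| ^ (p / (p + 2)) with hκ
  have hκ0 : 0 < κ := Real.rpow_pos_of_pos hs0 _
  have hκsq : (s ^ 2) ^ (p / (p + 2)) = κ ^ 2 := by
    rw [← sq_abs, ← Real.rpow_pow_comm hs0.le]
  have hκpow : κ ^ 2 * κ ^ p = |s| ^ p := by
    rw [← Real.rpow_natCast κ, ← Real.rpow_add hκ0, hκ, ← Real.rpow_mul hs0.le]
    congr 1
    push_cast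
    field_simp
    ring
  have hpot : ∀ t, κ ^ 2 * |κ * t| ^ p = |s * t| ^ p := fun t => by
    rw [abs_mul, abs_mul, Real.mul_rpow (abs_nonneg κ) (abs_nonneg t),
      Real.mul_rpow hs0.le (abs_nonneg t), abs_of_pos hκ0, ← mul_assoc, hκpow]
  rw [hκsq]
  simpa only [hpot] using groundEnergy_mul_sq_mul_integral_le hp hg hc hκ0

end Oscillator

section Slices

variable {n : ℕ}

theorem toLp_insertNth_eq_add_smul_single (i : Fin (n + 1)) (w : Fin n → ℝ) (t : ℝ) :
    WithLp.toLp 2 (i.insertNth t w : Fin (n + 1) → ℝ)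
      = WithLp.toLp 2 (i.insertNth 0 w : Fin (n + 1) → ℝ)
        + t • EuclideanSpace.single i (1 : ℝ) := by
  ext k
  refine Fin.succAboveCases i ?_ (fun k => ?_) k <;> simp

theorem integral_mono_of_slices {F G : EuclideanSpace ℝ (Fin (n + 1)) → ℝ} (hF : Integrable F)
    (hG : Integrable G) (i : Fin (n + 1))
    (hFG : ∀ w, w i = 0 → ∫ t : ℝ, F (w + t • EuclideanSpace.single i 1)
      ≤ ∫ t : ℝ, G (w + t • EuclideanSpace.single i 1)) :
    ∫ v, F v ≤ ∫ v, G v := by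
  let e : ℝ × (Fin n → ℝ) ≃ᵐ EuclideanSpace ℝ (Fin (n + 1)) :=
    (MeasurableEquiv.piFinSuccAbove (fun _ => ℝ) i).symm.trans
      (MeasurableEquiv.toLp 2 (Fin (n + 1) → ℝ))
  have he : MeasurePreserving e volume volume :=
    (PiLp.volume_preserving_toLp (Fin (n + 1))).comp
      ((volume_preserving_piFinSuccAbove (fun _ => ℝ) i).symm _)
  have heq : ∀ t w, e (t, w) = WithLp.toLp 2 (i.insertNth 0 w : Fin (n + 1) → ℝ)
      + t • EuclideanSpace.single i (1 : ℝ) := fun t w =>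
    toLp_insertNth_eq_add_smul_single i w t
  have hFe : Integrable fun z => F (e z) :=
    (he.integrable_comp_emb e.measurableEmbedding).2 hF
  have hGe : Integrable fun z => G (e z) :=
    (he.integrable_comp_emb e.measurableEmbedding).2 hG
  rw [← he.integral_comp' F, ← he.integral_comp' G, Measure.volume_eq_prod,
    integral_prod_symm _ hFe, integral_prod_symm _ hGe]
  refine integral_mono hFe.integral_prod_right hGe.integral_prod_right fun w => ?_
  simp only [heq]
  exact hFG _ (by simp)

variable {E : Type*} [NormedAddCommGroup E] [NormedSpace ℝ E] {F : Type*} [NormedAddCommGroup F]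

theorem isClosedEmbedding_add_smul (w : E) {e : E} (he : e ≠ 0) :
    IsClosedEmbedding fun t : ℝ => w + t • e :=
  (Homeomorph.addLeft w).isClosedEmbedding.comp (isClosedEmbedding_smul_left he)

theorem deriv_comp_add_smul [NormedSpace ℝ F] {f : E → F} (hf : Differentiable ℝ f) (w e : E)
    (t : ℝ) :
    deriv (fun t : ℝ => f (w + t • e)) t = fderiv ℝ f (w + t • e) e := by
  have hline : HasDerivAt (fun t : ℝ => w + t • e) e t := by
    simpa using ((hasDerivAt_id t).smul_const e).const_add w
  exact ((hf (w + t • e)).hasFDerivAt.comp_hasDerivAt t hline).deriv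

end Slices

section Channel

variable {n : ℕ} {p : ℝ}

theorem continuous_sq_rpow {X : Type*} [TopologicalSpace X] {f : X → ℝ} (hf : Continuous f) {a : ℝ}
    (ha : 0 ≤ a) : Continuous fun x => (f x ^ 2) ^ a :=
  (hf.pow 2).rpow_const fun _ => Or.inr ha

-- On the line in direction `j` through `w` the potential is `|w i * t| ^ p`.
theorem integral_groundEnergy_mul_le (hp : 0 < p) {i j : Fin (n + 1)} (hij : i ≠ j)
    {ψ : EuclideanSpace ℝ (Fin (n + 1)) → ℂ} (hψ : ContDiff ℝ ∞ ψ) (hc : HasCompactSupport ψ) :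
    ∫ v, groundEnergy p * ((v i) ^ 2) ^ (p / (p + 2)) * ‖ψ v‖ ^ 2
      ≤ ∫ v, (‖fderiv ℝ ψ v (EuclideanSpace.single j 1)‖ ^ 2 + |v i * v j| ^ p * ‖ψ v‖ ^ 2) := by
  refine integral_mono_of_slices ?_ ?_ j fun w hw => ?_
  · exact integrable_mul_norm_sq
      (continuous_const.mul (continuous_sq_rpow (by fun_prop) (by positivity))) hψ.continuous hc
  · exact (integrable_norm_sq (contDiff_fderiv_apply hψ _).continuous (hc.fderiv_apply ℝ _)).add
      (integrable_mul_norm_sq ((continuous_abs_rpow hp.le).comp (by fun_prop)) hψ.continuous hc)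
  · have hslice := groundEnergy_mul_rpow_mul_integral_le hp
      (g := fun t : ℝ => ψ (w + t • EuclideanSpace.single j 1)) (hψ.comp (by fun_prop))
      (hc.comp_isClosedEmbedding (isClosedEmbedding_add_smul w (by simp))) (w i)
    simp_rw [deriv_comp_add_smul (hψ.differentiable (by simp)), ← integral_const_mul] at hslice
    simpa [hij, hw] using hslice

end Channel

section Localization

theorem norm_sq_cos_sin_combination {c s : ℝ} (hcs : c ^ 2 + s ^ 2 = 1) (d : ℝ) (z z' : ℂ) :
    ‖(c : ℂ) * z' + ((-s * d : ℝ) : ℂ) * z‖ ^ 2 + ‖(s : ℂ) * z' + ((c * d : ℝ) : ℂ) * z‖ ^ 2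
      = ‖z'‖ ^ 2 + ‖d‖ ^ 2 * ‖z‖ ^ 2 := by
  simp only [← Complex.normSq_eq_norm_sq, Complex.normSq_apply, Complex.mul_re, Complex.add_re,
    Complex.add_im, Complex.mul_im, Complex.ofReal_re, Complex.ofReal_im, Real.norm_eq_abs, sq_abs]
  linear_combination (z'.re ^ 2 + z'.im ^ 2 + d ^ 2 * (z.re ^ 2 + z.im ^ 2)) * hcs

theorem norm_cos_mul_sq_add_norm_sin_mul_sq (t : ℝ) (z : ℂ) :
    ‖(Real.cos t : ℂ) * z‖ ^ 2 + ‖(Real.sin t : ℂ) * z‖ ^ 2 = ‖z‖ ^ 2 := by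
  rw [norm_ofReal_mul_sq, norm_ofReal_mul_sq, ← add_mul, Real.cos_sq_add_sin_sq, one_mul]

variable {E : Type*} [NormedAddCommGroup E] [InnerProductSpace ℝ E] {ι : Type*} [Fintype ι]
  {θ : E → ℝ} {ψ : E → ℂ}

theorem gradSq_cos_mul_add_gradSq_sin_mul (b : OrthonormalBasis ι ℝ E) (hθ : ContDiff ℝ ∞ θ)
    (hψ : ContDiff ℝ ∞ ψ) (x : E) :
    gradSq b (fun y => (Real.cos (θ y) : ℂ) * ψ y) x
      + gradSq b (fun y => (Real.sin (θ y) : ℂ) * ψ y) x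
      = gradSq b ψ x + gradSq b θ x * ‖ψ x‖ ^ 2 := by
  have hθx := (hθ.differentiable (by simp) x).hasFDerivAt
  simp only [gradSq, Finset.sum_mul, ← Finset.sum_add_distrib]
  refine Finset.sum_congr rfl fun i _ => ?_
  have hcos : fderiv ℝ (fun y => Real.cos (θ y)) x (b i)
      = -Real.sin (θ x) * fderiv ℝ θ x (b i) := by
    rw [hθx.cos.fderiv]; rfl
  have hsin : fderiv ℝ (fun y => Real.sin (θ y)) x (b i)
      = Real.cos (θ x) * fderiv ℝ θ x (b i) := by
    rw [hθx.sin.fderiv]; rfl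
  rw [fderiv_ofReal_mul_apply hθ.cos hψ, fderiv_ofReal_mul_apply hθ.sin hψ, hcos, hsin]
  exact norm_sq_cos_sin_combination (Real.cos_sq_add_sin_sq _) _ _ _

variable [FiniteDimensional ℝ E] [MeasurableSpace E] [BorelSpace E] {V : E → ℝ} {c : ℝ}

-- The IMS localization formula for the partition of unity `cos² θ + sin² θ = 1`.
theorem energy_cos_mul_add_energy_sin_mul (b : OrthonormalBasis ι ℝ E) (hV : Continuous V)
    (hθ : ContDiff ℝ ∞ θ) (hψ : ContDiff ℝ ∞ ψ) (hc : HasCompactSupport ψ) :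
    energy b V (fun y => (Real.cos (θ y) : ℂ) * ψ y)
      + energy b V (fun y => (Real.sin (θ y) : ℂ) * ψ y)
      = energy b V ψ + ∫ x, gradSq b θ x * ‖ψ x‖ ^ 2 := by
  have hcos := contDiff_ofReal_mul hθ.cos hψ
  have hsin := contDiff_ofReal_mul hθ.sin hψ
  have hdensity : ∀ {χ : E → ℂ}, ContDiff ℝ ∞ χ → HasCompactSupport χ →
      Integrable fun x => gradSq b χ x + V x * ‖χ x‖ ^ 2 := fun hχ hcχ =>
    (integrable_gradSq b hχ hcχ).add (integrable_mul_norm_sq hV hχ.continuous hcχ)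
  rw [energy, energy, energy, ← integral_add (hdensity hcos hc.mul_left)
    (hdensity hsin hc.mul_left), ← integral_add (hdensity hψ hc)
    (integrable_mul_norm_sq (continuous_gradSq b hθ) hψ.continuous hc)]
  congr with x
  linear_combination gradSq_cos_mul_add_gradSq_sin_mul b hθ hψ x
    + V x * norm_cos_mul_sq_add_norm_sin_mul_sq (θ x) (ψ x)

theorem integral_norm_cos_mul_sq_add_integral_norm_sin_mul_sq (hθ : Continuous θ)
    (hψ : Continuous ψ) (hc : HasCompactSupport ψ) :
    (∫ x, ‖(Real.cos (θ x) : ℂ) * ψ x‖ ^ 2) + ∫ x, ‖(Real.sin (θ x) : ℂ) * ψ x‖ ^ 2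
      = ∫ x, ‖ψ x‖ ^ 2 := by
  have hmul : ∀ χ : E → ℝ, Continuous χ → Integrable fun x => ‖(χ x : ℂ) * ψ x‖ ^ 2 := fun χ hχ =>
    integrable_norm_sq ((Complex.continuous_ofReal.comp hχ).mul hψ) hc.mul_left
  rw [← integral_add (hmul (fun x => Real.cos (θ x)) (by fun_prop))
    (hmul (fun x => Real.sin (θ x)) (by fun_prop))]
  simp only [norm_cos_mul_sq_add_norm_sin_mul_sq]

theorem le_energy_of_le_energy_cos_sin {b : OrthonormalBasis ι ℝ E} (hV : Continuous V)
    (hθ : ContDiff ℝ ∞ θ) {M : ℝ} (hM : ∀ x, gradSq b θ x ≤ M) (hψ : ContDiff ℝ ∞ ψ)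
    (hc : HasCompactSupport ψ)
    (hcos : c * ∫ x, ‖(Real.cos (θ x) : ℂ) * ψ x‖ ^ 2
      ≤ energy b V fun x => (Real.cos (θ x) : ℂ) * ψ x)
    (hsin : c * ∫ x, ‖(Real.sin (θ x) : ℂ) * ψ x‖ ^ 2
      ≤ energy b V fun x => (Real.sin (θ x) : ℂ) * ψ x) :
    (c - M) * ∫ x, ‖ψ x‖ ^ 2 ≤ energy b V ψ := by
  have hgrad : ∫ x, gradSq b θ x * ‖ψ x‖ ^ 2 ≤ M * ∫ x, ‖ψ x‖ ^ 2 := by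
    rw [← integral_const_mul]
    refine integral_mono (integrable_mul_norm_sq (continuous_gradSq b hθ) hψ.continuous hc)
      ((integrable_norm_sq hψ.continuous hc).const_mul M) fun x => ?_
    exact mul_le_mul_of_nonneg_right (hM x) (sq_nonneg _)
  have hIMS := energy_cos_mul_add_energy_sin_mul b hV hθ hψ hc
  have hmass := congrArg (c * ·)
    (integral_norm_cos_mul_sq_add_integral_norm_sin_mul_sq hθ.continuous hψ.continuous hc)
  linarith

theorem mul_integral_norm_sq_le_energy_of_le (b : OrthonormalBasis ι ℝ E) (hV : Continuous V)
    (hψ : ContDiff ℝ ∞ ψ) (hc : HasCompactSupport ψ) (h : ∀ x, ψ x ≠ 0 → c ≤ V x) :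
    c * ∫ x, ‖ψ x‖ ^ 2 ≤ energy b V ψ := by
  rw [← integral_const_mul]
  refine integral_mono ((integrable_norm_sq hψ.continuous hc).const_mul c)
    ((integrable_gradSq b hψ hc).add (integrable_mul_norm_sq hV hψ.continuous hc)) fun x => ?_
  refine le_add_of_nonneg_of_le (gradSq_nonneg b ψ x) ?_
  by_cases h0 : ψ x = 0
  · simp [h0]
  · exact mul_le_mul_of_nonneg_right (h x h0) (sq_nonneg _)

end Localization

section Angle

/-- A smooth angle equal to `0` for `t ^ 2 ≤ 1` and to `π / 2` for `2 ≤ t ^ 2`, so that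
`cos² (angle t) + sin² (angle t) = 1` is a partition of unity separating a neighbourhood of `0`
from its complement. -/
def angle (t : ℝ) : ℝ := Real.pi / 2 * Real.smoothTransition (t ^ 2 - 1)

theorem contDiff_angle : ContDiff ℝ ∞ angle :=
  contDiff_const.mul (Real.smoothTransition.contDiff.comp ((contDiff_id.pow 2).sub contDiff_const))

theorem angle_eq_zero {t : ℝ} (ht : t ^ 2 ≤ 1) : angle t = 0 := by
  rw [angle, Real.smoothTransition.zero_of_nonpos (by linarith), mul_zero]

theorem angle_eq_pi_div_two {t : ℝ} (ht : 2 ≤ t ^ 2) : angle t = Real.pi / 2 := by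
  rw [angle, Real.smoothTransition.one_of_one_le (by linarith), mul_one]

theorem sq_le_two_of_cos_angle_ne_zero {t : ℝ} (h : Real.cos (angle t) ≠ 0) : t ^ 2 ≤ 2 := by
  by_contra! ht
  exact h (by rw [angle_eq_pi_div_two ht.le, Real.cos_pi_div_two])

theorem one_le_sq_of_sin_angle_ne_zero {t : ℝ} (h : Real.sin (angle t) ≠ 0) : 1 ≤ t ^ 2 := by
  by_contra! ht
  exact h (by rw [angle_eq_zero ht.le, Real.sin_zero])

theorem hasCompactSupport_deriv_angle : HasCompactSupport (deriv angle) := by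
  refine HasCompactSupport.intro (isCompact_Icc (a := (-2 : ℝ)) (b := 2)) fun t ht => ?_
  have hconst : angle =ᶠ[𝓝 t] fun _ => Real.pi / 2 := by
    filter_upwards [isClosed_Icc.isOpen_compl.mem_nhds ht] with s hs
    refine angle_eq_pi_div_two ?_
    by_contra! hs2
    exact hs ⟨by nlinarith, by nlinarith⟩
  rw [hconst.deriv_eq, deriv_const]

theorem exists_norm_deriv_angle_sq_le : ∃ M, ∀ t, ‖deriv angle t‖ ^ 2 ≤ M := by
  obtain ⟨M, hM⟩ := (contDiff_angle.continuous_deriv (by simp)).bounded_above_of_compact_support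
    hasCompactSupport_deriv_angle
  exact ⟨M ^ 2, fun t => by gcongr; exact hM t⟩

theorem gradSq_comp_coord {ι : Type*} [Fintype ι] {f : ℝ → ℝ}
    (hf : Differentiable ℝ f) (j : ι) (v : EuclideanSpace ℝ ι) :
    gradSq (EuclideanSpace.basisFun ι ℝ) (fun v => f (v j)) v = ‖deriv f (v j)‖ ^ 2 := by
  classical
  have hcoord : HasFDerivAt (fun v : EuclideanSpace ℝ ι => f (v j))
      (deriv f (v j) • (EuclideanSpace.proj j : EuclideanSpace ℝ ι →L[ℝ] ℝ)) v :=
    (hf (v j)).hasDerivAt.comp_hasFDerivAt v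
      (EuclideanSpace.proj j : EuclideanSpace ℝ ι →L[ℝ] ℝ).hasFDerivAt
  simp [gradSq, hcoord.fderiv]

end Angle

section Potential

/-- The plane `ℝ²` with its Euclidean norm, on which `L p lam` acts. -/
abbrev Plane : Type := EuclideanSpace ℝ (Fin 2)

/-- The standard orthonormal basis of the plane, in which `gradSq` is expressed. -/
abbrev planeBasis : OrthonormalBasis (Fin 2) ℝ Plane := EuclideanSpace.basisFun (Fin 2) ℝ

/-- The potential `|x y|^p - c (x² + y²)^{p/(p+2)}` of `L p c`. -/
def potential (p c : ℝ) (v : Plane) : ℝ :=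
  |v 0 * v 1| ^ p - c * ((v 0) ^ 2 + (v 1) ^ 2) ^ (p / (p + 2))

variable {p : ℝ} {i j : Fin 2}

theorem potential_eq_of_ne (hij : i ≠ j) (c : ℝ) (v : Plane) :
    potential p c v = |v i * v j| ^ p - c * ((v i) ^ 2 + (v j) ^ 2) ^ (p / (p + 2)) := by
  rw [potential]
  fin_cases i <;> fin_cases j <;> simp_all [mul_comm, add_comm]

theorem gradSq_planeBasis_of_ne (hij : i ≠ j) (ψ : Plane → ℂ) (v : Plane) :
    gradSq planeBasis ψ v = ‖fderiv ℝ ψ v (EuclideanSpace.single i 1)‖ ^ 2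
      + ‖fderiv ℝ ψ v (EuclideanSpace.single j 1)‖ ^ 2 := by
  rw [gradSq]
  fin_cases i <;> fin_cases j <;> simp_all [add_comm]

theorem continuous_sq_add_sq_rpow {a : ℝ} (ha : 0 ≤ a) :
    Continuous fun v : Plane => ((v 0) ^ 2 + (v 1) ^ 2) ^ a :=
  Continuous.rpow_const (by fun_prop) fun _ => Or.inr ha

theorem tendsto_sq_add_sq_rpow {a : ℝ} (ha : 0 < a) :
    Tendsto (fun v : Plane => ((v 0) ^ 2 + (v 1) ^ 2) ^ a) (cocompact Plane) atTop := by
  have hnorm : ∀ v : Plane, (v 0) ^ 2 + (v 1) ^ 2 = ‖v‖ ^ 2 := fun v => by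
    rw [EuclideanSpace.real_norm_sq_eq, Fin.sum_univ_two]
  simp_rw [hnorm]
  exact (tendsto_rpow_atTop ha).comp
    ((tendsto_pow_atTop two_ne_zero).comp (tendsto_norm_cocompact_atTop (E := Plane)))

theorem continuous_potential (hp : 0 < p) (c : ℝ) : Continuous (potential p c) :=
  ((continuous_abs_rpow hp.le).comp (by fun_prop)).sub
    (continuous_const.mul (continuous_sq_add_sq_rpow (by positivity)))

theorem exists_forall_mul_rpow_le {a q c d : ℝ} (ha : 0 ≤ a) (haq : a < q) (hc : 0 ≤ c)
    (hd : 0 < d) : ∃ C, ∀ s : ℝ, 0 ≤ s → c * s ^ a ≤ d * s ^ q + C := by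
  have hlarge : ∀ᶠ s : ℝ in atTop, c * s ^ a ≤ d * s ^ q := by
    filter_upwards [(tendsto_rpow_atTop (sub_pos.2 haq)).eventually_ge_atTop (c / d),
      eventually_gt_atTop 0] with s hs hs0
    calc c * s ^ a ≤ d * s ^ (q - a) * s ^ a := by
          gcongr
          exact (div_le_iff₀' hd).1 hs
      _ = d * s ^ q := by rw [mul_assoc, ← Real.rpow_add hs0, sub_add_cancel]
  obtain ⟨S, hS⟩ := eventually_atTop.1 hlarge
  refine ⟨c * max S 0 ^ a, fun s hs => ?_⟩
  rcases le_total S s with hSs | hsS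
  · exact le_add_of_le_of_nonneg (hS s hSs) (by positivity)
  · refine le_add_of_nonneg_of_le (by positivity) ?_
    gcongr
    exact hsS.trans (le_max_left S 0)

-- Away from the axes `x² + y² ≤ 2 (x y)²`, so the first term of the potential dominates.
theorem exists_forall_le_potential (hp : 0 < p) {c : ℝ} (hc : 0 ≤ c) :
    ∃ C, ∀ v : Plane, 1 ≤ (v 0) ^ 2 → 1 ≤ (v 1) ^ 2 → C ≤ potential p c v := by
  have hexp : p / (p + 2) < p / 2 := div_lt_div_of_pos_left hp two_pos (by linarith)
  obtain ⟨C, hC⟩ := exists_forall_mul_rpow_le (by positivity) hexp hc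
    (d := (1 / 2) ^ (p / 2)) (by positivity)
  refine ⟨-C, fun v h0 h1 => ?_⟩
  have hprod : 1 / 2 * ((v 0) ^ 2 + (v 1) ^ 2) ≤ |v 0 * v 1| ^ 2 := by
    rw [sq_abs, mul_pow]
    nlinarith
  have hpow : (1 / 2) ^ (p / 2) * ((v 0) ^ 2 + (v 1) ^ 2) ^ (p / 2) ≤ |v 0 * v 1| ^ p := by
    calc (1 / 2) ^ (p / 2) * ((v 0) ^ 2 + (v 1) ^ 2) ^ (p / 2)
        = (1 / 2 * ((v 0) ^ 2 + (v 1) ^ 2)) ^ (p / 2) :=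
          (Real.mul_rpow (by positivity) (by positivity)).symm
      _ ≤ (|v 0 * v 1| ^ 2) ^ (p / 2) := by gcongr
      _ = |v 0 * v 1| ^ p := by
          rw [← Real.rpow_natCast, ← Real.rpow_mul (abs_nonneg _)]
          congr 1
          push_cast
          ring
  have hradial := hC ((v 0) ^ 2 + (v 1) ^ 2) (by positivity)
  rw [potential]
  linarith

end Potential

section CriticalCoupling

variable {p : ℝ} {i j : Fin 2} {ψ : Plane → ℂ}

theorem add_rpow_le_rpow_add_rpow {a x y : ℝ} (ha0 : 0 ≤ a) (ha1 : a ≤ 1) (hx : 0 ≤ x)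
    (hy : 0 ≤ y) : (x + y) ^ a ≤ x ^ a + y ^ a := by
  lift x to NNReal using hx
  lift y to NNReal using hy
  exact_mod_cast NNReal.rpow_add_le_add_rpow x y ha0 ha1

theorem channel_density_le (hp : 0 < p) (hij : i ≠ j) {r : ℝ} {v : Plane}
    (hr : ψ v ≠ 0 → (v j) ^ 2 ≤ r) :
    ‖fderiv ℝ ψ v (EuclideanSpace.single j 1)‖ ^ 2 + |v i * v j| ^ p * ‖ψ v‖ ^ 2
      ≤ gradSq planeBasis ψ v + potential p (groundEnergy p) v * ‖ψ v‖ ^ 2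
        + groundEnergy p * ((v i) ^ 2) ^ (p / (p + 2)) * ‖ψ v‖ ^ 2
        + groundEnergy p * r ^ (p / (p + 2)) * ‖ψ v‖ ^ 2 := by
  rw [gradSq_planeBasis_of_ne hij, potential_eq_of_ne hij]
  have hγ := groundEnergy_nonneg hp
  have ha1 : p / (p + 2) ≤ 1 := (div_le_one (by positivity)).2 (by linarith)
  have hradial : groundEnergy p * ((v i) ^ 2 + (v j) ^ 2) ^ (p / (p + 2)) * ‖ψ v‖ ^ 2
      ≤ groundEnergy p * (((v i) ^ 2) ^ (p / (p + 2)) + r ^ (p / (p + 2))) * ‖ψ v‖ ^ 2 := by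
    by_cases h0 : ψ v = 0
    · simp [h0]
    · gcongr
      refine (add_rpow_le_rpow_add_rpow (by positivity) ha1 (by positivity)
        (by positivity)).trans ?_
      gcongr
      exact hr h0
  linarith [sq_nonneg ‖fderiv ℝ ψ v (EuclideanSpace.single i 1)‖]

theorem neg_mul_integral_le_energy_of_channel (hp : 0 < p) (hij : i ≠ j) (hψ : ContDiff ℝ ∞ ψ)
    (hc : HasCompactSupport ψ) {r : ℝ} (hr : ∀ v, ψ v ≠ 0 → (v j) ^ 2 ≤ r) :
    -(groundEnergy p * r ^ (p / (p + 2))) * ∫ v, ‖ψ v‖ ^ 2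
      ≤ energy planeBasis (potential p (groundEnergy p)) ψ := by
  have hdensity : Integrable fun v : Plane =>
      ‖fderiv ℝ ψ v (EuclideanSpace.single j 1)‖ ^ 2 + |v i * v j| ^ p * ‖ψ v‖ ^ 2 :=
    (integrable_norm_sq (contDiff_fderiv_apply hψ _).continuous (hc.fderiv_apply ℝ _)).add
      (integrable_mul_norm_sq ((continuous_abs_rpow hp.le).comp (by fun_prop)) hψ.continuous hc)
  have henergy : Integrable fun v =>
      gradSq planeBasis ψ v + potential p (groundEnergy p) v * ‖ψ v‖ ^ 2 :=
    (integrable_gradSq planeBasis hψ hc).add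
      (integrable_mul_norm_sq (continuous_potential hp _) hψ.continuous hc)
  have haxis : Integrable fun v : Plane =>
      groundEnergy p * ((v i) ^ 2) ^ (p / (p + 2)) * ‖ψ v‖ ^ 2 :=
    integrable_mul_norm_sq
      (continuous_const.mul (continuous_sq_rpow (by fun_prop) (by positivity))) hψ.continuous hc
  have hconst := (integrable_norm_sq hψ.continuous hc).const_mul
    (groundEnergy p * r ^ (p / (p + 2)))
  have hle := integral_mono hdensity ((henergy.fun_add haxis).fun_add hconst)
    fun v => channel_density_le hp hij (hr v)
  rw [integral_add (henergy.fun_add haxis) hconst, integral_add henergy haxis,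
    integral_const_mul, ← energy] at hle
  linarith [integral_groundEnergy_mul_le hp hij hψ hc]

theorem contDiff_angle_coord (j : Fin 2) : ContDiff ℝ ∞ fun v : Plane => angle (v j) :=
  contDiff_angle.comp (by fun_prop)

theorem neg_mul_integral_le_energy_cos_angle_mul (hp : 0 < p) (j : Fin 2) (hψ : ContDiff ℝ ∞ ψ)
    (hc : HasCompactSupport ψ) :
    -(groundEnergy p * 2 ^ (p / (p + 2))) * ∫ v, ‖(Real.cos (angle (v j)) : ℂ) * ψ v‖ ^ 2
      ≤ energy planeBasis (potential p (groundEnergy p))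
        fun v => (Real.cos (angle (v j)) : ℂ) * ψ v := by
  obtain ⟨i, hij⟩ := exists_ne j
  refine neg_mul_integral_le_energy_of_channel hp hij
    (contDiff_ofReal_mul (contDiff_angle_coord j).cos hψ) hc.mul_left fun v hv => ?_
  exact sq_le_two_of_cos_angle_ne_zero
    (Complex.ofReal_ne_zero.1 (left_ne_zero_of_mul hv))

-- Localize first in the second coordinate and then in the first one: the two `cos` parts live in
-- the channels along the axes, the remaining part lives away from the axes.
theorem exists_mul_integral_le_energy_potential_groundEnergy (hp : 0 < p) :
    ∃ C, ∀ ψ : Plane → ℂ, ContDiff ℝ ∞ ψ → HasCompactSupport ψ →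
      C * ∫ v, ‖ψ v‖ ^ 2 ≤ energy planeBasis (potential p (groundEnergy p)) ψ := by
  obtain ⟨M, hM⟩ := exists_norm_deriv_angle_sq_le
  have hgrad : ∀ j v, gradSq planeBasis (fun v : Plane => angle (v j)) v ≤ M := fun j v => by
    rw [gradSq_comp_coord (contDiff_angle.differentiable (by simp))]
    exact hM _
  have hM0 : 0 ≤ M := (sq_nonneg _).trans (hM 0)
  obtain ⟨C₁, hC₁⟩ := exists_forall_le_potential hp (groundEnergy_nonneg hp)
  set C₂ := -(groundEnergy p * 2 ^ (p / (p + 2)))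
  have weaken : ∀ {c c' A : ℝ} {χ : Plane → ℂ}, c ≤ c' → c' * ∫ v, ‖χ v‖ ^ 2 ≤ A →
      c * ∫ v, ‖χ v‖ ^ 2 ≤ A := fun hcc' hA =>
    (mul_le_mul_of_nonneg_right hcc' (integral_nonneg fun _ => sq_nonneg _)).trans hA
  refine ⟨min C₁ C₂ - M - M, fun ψ hψ hc => ?_⟩
  have hV := continuous_potential hp (groundEnergy p)
  have hθ := contDiff_angle_coord
  have hχ := contDiff_ofReal_mul (hθ 1).sin hψ
  have hχc : HasCompactSupport fun v : Plane => (Real.sin (angle (v 1)) : ℂ) * ψ v := hc.mul_left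
  refine le_energy_of_le_energy_cos_sin hV (hθ 1) (hgrad 1) hψ hc
    (weaken ((sub_le_self _ hM0).trans (min_le_right _ _))
      (neg_mul_integral_le_energy_cos_angle_mul hp 1 hψ hc))
    (le_energy_of_le_energy_cos_sin hV (hθ 0) (hgrad 0) hχ hχc
      (weaken (min_le_right _ _) (neg_mul_integral_le_energy_cos_angle_mul hp 0 hχ hχc))
      (weaken (min_le_left _ _) (mul_integral_norm_sq_le_energy_of_le planeBasis hV
        (contDiff_ofReal_mul (hθ 0).sin hχ) hχc.mul_left fun v hv => ?_)))
  have hsin0 := left_ne_zero_of_mul hv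
  have hsin1 := left_ne_zero_of_mul (right_ne_zero_of_mul hv)
  exact hC₁ v (one_le_sq_of_sin_angle_ne_zero (Complex.ofReal_ne_zero.1 hsin0))
    (one_le_sq_of_sin_angle_ne_zero (Complex.ofReal_ne_zero.1 hsin1))

end CriticalCoupling

section SubcriticalCoupling

theorem integral_le_energy_of_convex_combination_le {E : Type*} [NormedAddCommGroup E]
    [InnerProductSpace ℝ E] [FiniteDimensional ℝ E] [MeasurableSpace E] [BorelSpace E] {ι : Type*}
    [Fintype ι] {b : OrthonormalBasis ι ℝ E} {V₀ V W : E → ℝ} (hV₀ : Continuous V₀)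
    (hV : Continuous V) (hW : Continuous W) {ε C : ℝ} (hε : ε ≤ 1)
    (hle : ∀ x, (1 - ε) * V₀ x + W x ≤ V x) {ψ : E → ℂ} (hψ : ContDiff ℝ ∞ ψ)
    (hc : HasCompactSupport ψ) (hC : C * ∫ x, ‖ψ x‖ ^ 2 ≤ energy b V₀ ψ) :
    ∫ x, (ε * gradSq b ψ x + (W x + (1 - ε) * C) * ‖ψ x‖ ^ 2) ≤ energy b V ψ := by
  have hgrad := integrable_gradSq b hψ hc
  have hmass := integrable_norm_sq hψ.continuous hc
  have hpot : ∀ {U : E → ℝ}, Continuous U → Integrable fun x => U x * ‖ψ x‖ ^ 2 := fun hU =>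
    integrable_mul_norm_sq hU hψ.continuous hc
  have hεW : Integrable fun x => ε * gradSq b ψ x + W x * ‖ψ x‖ ^ 2 :=
    (hgrad.const_mul ε).add (hpot hW)
  calc ∫ x, (ε * gradSq b ψ x + (W x + (1 - ε) * C) * ‖ψ x‖ ^ 2)
      = (∫ x, (ε * gradSq b ψ x + W x * ‖ψ x‖ ^ 2)) + (1 - ε) * (C * ∫ x, ‖ψ x‖ ^ 2) := by
        rw [← mul_assoc, ← integral_const_mul, ← integral_add hεW (hmass.const_mul _)]
        simp_rw [add_mul, add_assoc]
    _ ≤ (∫ x, (ε * gradSq b ψ x + W x * ‖ψ x‖ ^ 2)) + (1 - ε) * energy b V₀ ψ :=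
        add_le_add_right (mul_le_mul_of_nonneg_left hC (sub_nonneg.2 hε)) _
    _ = ∫ x, (gradSq b ψ x + ((1 - ε) * V₀ x + W x) * ‖ψ x‖ ^ 2) := by
        rw [energy, ← integral_const_mul,
          ← integral_add hεW ((hgrad.fun_add (hpot hV₀)).const_mul _)]
        congr with x
        ring
    _ ≤ energy b V ψ := by
        refine integral_mono (hgrad.fun_add (hpot (by fun_prop))) (hgrad.fun_add (hpot hV))
          fun x => ?_
        gcongr
        exact hle x

theorem exists_isCompactResolvent_L {p : ℝ} (hp : 0 < p) {lam : ℝ} (hlam : lam < groundEnergy p) :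
    ∃ μ R, IsCompactResolvent (L p lam) μ R := by
  have hγ := groundEnergy_nonneg hp
  obtain ⟨C, hC⟩ := exists_mul_integral_le_energy_potential_groundEnergy hp
  set γ := groundEnergy p
  set δ := (γ - lam) / 2 with hδ
  have hδ0 : 0 < δ := half_pos (sub_pos.2 hlam)
  set ε := δ / (γ + δ) with hε
  have hε0 : 0 < ε := by positivity
  have hε1 : ε ≤ 1 := (div_le_one (by positivity)).2 (le_add_of_nonneg_left hγ)
  have hεγ : ε * γ ≤ δ := by
    rw [hε, div_mul_eq_mul_div, div_le_iff₀ (by positivity)]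
    gcongr
    exact le_add_of_nonneg_right hδ0.le
  have hr : Continuous fun v : Plane => δ * ((v 0) ^ 2 + (v 1) ^ 2) ^ (p / (p + 2)) :=
    continuous_const.mul (continuous_sq_add_sq_rpow (by positivity))
  refine exists_isCompactResolvent_schrodinger (b := planeBasis) (continuous_potential hp lam)
    (hr.add continuous_const) (tendsto_atTop_add_const_right _ ((1 - ε) * C)
      ((tendsto_sq_add_sq_rpow (by positivity)).const_mul_atTop hδ0)) hε0 fun ψ hψ hc =>
    integral_le_energy_of_convex_combination_le (continuous_potential hp γ)
      (continuous_potential hp lam) hr hε1 (fun v => ?_) hψ hc (hC ψ hψ hc)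
  rw [potential, potential]
  set r := ((v 0) ^ 2 + (v 1) ^ 2) ^ (p / (p + 2))
  have hεr : ε * γ * r ≤ δ * r := by gcongr
  have hεX : 0 ≤ ε * |v 0 * v 1| ^ p := by positivity
  linear_combination hεr + hεX + 2 * r * hδ

end SubcriticalCoupling

end Schrodinger

end

theorem theorem2p1_general (p : ℝ) (hp : 0 < p) :
    IsLeast {μ : ℝ | Schrodinger.IsEigenvalue (Schrodinger.oscillator p) (μ : ℂ)}
      (Schrodinger.groundEnergy p) ∧
    ∀ lam : ℝ, lam < Schrodinger.groundEnergy p →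
      IsSelfAdjoint (Schrodinger.L p lam) ∧
      (∃ c : ℝ, Schrodinger.IsBoundedBelowBy (Schrodinger.L p lam) c ∧
        Schrodinger.spectrum (Schrodinger.L p lam) ⊆ (fun x : ℝ => (x : ℂ)) '' Set.Ici c) ∧
      Schrodinger.HasPurelyDiscreteSpectrum (Schrodinger.L p lam) := by
  refine ⟨Schrodinger.isLeast_groundEnergy hp, fun lam hlam => ?_⟩
  obtain ⟨μ, R, hR⟩ := Schrodinger.exists_isCompactResolvent_L hp hlam
  exact ⟨hR.isSelfAdjoint, ⟨1 - μ, hR.isBoundedBelowBy, hR.spectrum_subset⟩,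
    hR.hasPurelyDiscreteSpectrum⟩

/-- For `p ≥ 1`, the ground-state energy `γ_p` of `-d²/dt² + |t|^p` is attained as its least
eigenvalue, and for `0 ≤ lam < γ_p` the operator `L_p(lam)` is self-adjoint, bounded from below
(so that its spectrum lies in some half-line `[c, ∞)`), and has purely discrete spectrum. -/
theorem theorem2p1 (p : ℝ) (hp : 1 ≤ p) :
    IsLeast {μ : ℝ | Schrodinger.IsEigenvalue (Schrodinger.oscillator p) (μ : ℂ)}
      (Schrodinger.groundEnergy p) ∧
    ∀ lam : ℝ, 0 ≤ lam → lam < Schrodinger.groundEnergy p →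
      IsSelfAdjoint (Schrodinger.L p lam) ∧
      (∃ c : ℝ, Schrodinger.IsBoundedBelowBy (Schrodinger.L p lam) c ∧
        Schrodinger.spectrum (Schrodinger.L p lam) ⊆ (fun x : ℝ => (x : ℂ)) '' Set.Ici c) ∧
      Schrodinger.HasPurelyDiscreteSpectrum (Schrodinger.L p lam) := by
  obtain ⟨hground, hL⟩ := theorem2p1_general p (zero_lt_one.trans_le hp)
  exact ⟨hground, fun lam _ hlam => hL lam hlam⟩
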